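/- Let $N\ge 2$ be even, let $S\in\{0,\tfrac12,1,\tfrac32,\dots\}$, and put $\eta_\alpha=e^{2\pi i\alpha/N}$ for $\alpha=1,\dots,N$. Consider a chain of $N$ sites carrying Schwinger bosons: operators $a_\alpha,a_\alpha^\dagger,b_\alpha,b_\alpha^\dagger$ on the bosonic Fock space with the usual commutation relations $[a_\alpha,a_\beta^\dagger]=[b_\alpha,b_\beta^\dagger]=\delta_{\alpha\beta}$ (all other commutators vanish) and vacuum $|0\rangle$, and the spin operators $S^x_\alpha=\tfrac12(a_\alpha^\dagger b_\alpha+b_\alpha^\dagger a_\alpha)$, $S^y_\alpha=\tfrac1{2i}(a_\alpha^\dagger b_\alpha-b_\alpha^\dagger a_\alpha)$, $S^z_\alpha=\tfrac12(a_\alpha^\dagger a_\alpha-b_\alpha^\dagger b_\alpha)$. The state space of the spin-$S$ chain is the subspace of the Fock space on which $a_\alpha^\dagger a_\alpha+b_\alpha^\dagger b_\alpha=2S$ for every $\alpha$. Let $$\Psi^{\rm HS}_0[a^\dagger,b^\dagger]=\sum_{\{z_1,\dots,z_M\}}\ \prod_{i<j}(z_i-z_j)^2\prod_{i=1}^{M}z_i\;\;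 a^\dagger_{z_1}\cdots a^\dagger_{z_M}\,b^\dagger_{w_1}\cdots b^\dagger_{w_M},\qquad M=\tfrac N2,$$ where the sum runs over all $M$-element subsets $\{z_1,\dots,z_M\}$ of $\{\eta_1,\dots,\eta_N\}$, $w_1,\dots,w_M$ are the remaining sites, and a site is labelled by its position. Put $$|\psi^S_0\rangle=\big(\Psi^{\rm HS}_0[a^\dagger,b^\dagger]\big)^{2S}|0\rangle,$$ $$H^S=\frac{2\pi^2}{N^2}\Bigg[\sum_{\alpha\ne\beta}\frac{\boldsymbol S_\alpha\cdot\boldsymbol S_\beta}{|\eta_\alpha-\eta_\beta|^2}-\frac1{2(S+1)(2S+3)}\sum_{\substack{\alpha,\beta,\gamma\\ \alpha\ne\beta,\ \alpha\ne\gamma}}\frac{(\boldsymbol S_\alpha\cdot\boldsymbol S_\beta)(\boldsymbol S_\alpha\cdot\boldsymbol S_\gamma)+(\boldsymbol S_\alpha\cdot\boldsymbol S_\gamma)(\boldsymbol S_\alpha\cdot\boldsymbol S_\beta)}{(\bar\eta_\alpha-\bar\eta_\beta)(\eta_\alpha-\eta_\gamma)}\Bigg],$$ where $\beta=\gamma$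 is allowed in the last sum. Then $H^S$ maps the state space of the spin-$S$ chain to itself, $|\psi^S_0\rangle$ is a non-zero element of this space, and $$H^S|\psi^S_0\rangle=E^S_0|\psi^S_0\rangle,\qquad E^S_0=-\frac{2\pi^2}{N^2}\,\frac{S(S+1)^2}{2S+3}\,\frac{N(N^2+5)}{12}=-\frac{\pi^2}{6}\,\frac{S(S+1)^2}{2S+3}\Big(N+\frac5N\Big).$$ Moreover, $$H^S=\frac{2\pi^2}{N^2}\Bigg[\sum_{\alpha\ne\beta}\frac{\boldsymbol S_\alpha\cdot\boldsymbol S_\beta}{|\eta_\alpha-\eta_\beta|^2}-\sum_{\substack{\alpha,\beta,\gamma\\ \alpha\ne\beta,\ \alpha\ne\gamma}}\operatorname{Re}\Big\{\frac1{(\bar\eta_\alpha-\bar\eta_\beta)(\eta_\alpha-\eta_\gamma)}\Big\}\frac{(\boldsymbol S_\alpha\cdot\boldsymbol S_\beta)(\boldsymbol S_\alpha\cdot\boldsymbol S_\gamma)}{(S+1)(2S+3)}\Bigg].$$ -/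

import Mathlib

/-!
Spin chains in terms of Schwinger bosons.

The bosonic Fock space with two boson species per site is realised on the polynomials in
variables `X (α, 0)`, `X (α, 1)`: the monomial `∏ X (α, 0) ^ m α * X (α, 1) ^ n α` is the state
`∏ (a†_α) ^ m α (b†_α) ^ n α |0⟩`, creation operators multiply by a variable, and annihilation
operators differentiate.
-/

noncomputable section

namespace SpinChain

open scoped ComplexConjugate

/-- The (algebraic) Fock space of the Schwinger bosons `a` (species `0`) and `b` (species `1`) on
the `N` sites of the chain. -/
abbrev Fock (N : ℕ) : Type := MvPolynomial (Fin N × Fin 2) ℂ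

/-- Linear operators on the Fock space; the product is composition. -/
abbrev Op (N : ℕ) : Type := Module.End ℂ (Fock N)

/-- The bosonic vacuum `|0⟩`. -/
def vac (N : ℕ) : Fock N := 1

/-- The creation operator of the boson mode `i`. -/
def create {N : ℕ} (i : Fin N × Fin 2) : Op N := LinearMap.mulLeft ℂ (MvPolynomial.X i)

/-- The annihilation operator of the boson mode `i`. -/
def annihilate {N : ℕ} (i : Fin N × Fin 2) : Op N := (MvPolynomial.pderiv i).toLinearMap

/-- Annihilation operators kill the vacuum. -/
theorem annihilate_vac {N : ℕ} (i : Fin N × Fin 2) : annihilate i (vac N) = 0 := by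
  simp [annihilate, vac]

/-- The canonical commutation relation between annihilation and creation operators. -/
theorem annihilate_create_comm {N : ℕ} (i j : Fin N × Fin 2) :
    annihilate i * create j - create j * annihilate i = if i = j then 1 else 0 := by
  refine LinearMap.ext fun p => ?_
  by_cases h : i = j
  · subst h
    simp [annihilate, create, Module.End.mul_apply]
  · simp [annihilate, create, Module.End.mul_apply, h,
      MvPolynomial.pderiv_X_of_ne (Ne.symm h)]

/-- `a†_α` -/
def aDag {N : ℕ} (α : Fin N) : Op N := create (α, 0)

/-- `a_α` -/
def aOp {N : ℕ} (α : Fin N) : Op N := annihilate (α, 0)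

/-- `b†_α` -/
def bDag {N : ℕ} (α : Fin N) : Op N := create (α, 1)

/-- `b_α` -/
def bOp {N : ℕ} (α : Fin N) : Op N := annihilate (α, 1)

/-- `S^x_α = (a† b + b† a) / 2` -/
def Sx {N : ℕ} (α : Fin N) : Op N := (1 / 2 : ℂ) • (aDag α * bOp α + bDag α * aOp α)

/-- `S^y_α = (a† b - b† a) / (2 i)` -/
def Sy {N : ℕ} (α : Fin N) : Op N :=
  (1 / (2 * Complex.I) : ℂ) • (aDag α * bOp α - bDag α * aOp α)

/-- `S^z_α = (a† a - b† b) / 2` -/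
def Sz {N : ℕ} (α : Fin N) : Op N := (1 / 2 : ℂ) • (aDag α * aOp α - bDag α * bOp α)

/-- The scalar product `𝐒_α · 𝐒_β` of the spin operators at two sites. -/
def SS {N : ℕ} (α β : Fin N) : Op N := Sx α * Sx β + Sy α * Sy β + Sz α * Sz β

/-- The state space of the chain with spin `twoS / 2` at each site: the states with
`a†_α a_α + b†_α b_α = twoS` at each site `α`. -/
def spinSpace (N twoS : ℕ) : Submodule ℂ (Fock N) :=
  ⨅ α : Fin N, Module.End.eigenspace (aDag α * aOp α + bDag α * bOp α) (twoS : ℂ)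

/-- The position `η_α = exp (2 π i α / N)` of a site on the unit circle; the sites are numbered
`α = 1, …, N`, so the site with index `α : Fin N` has number `α + 1`. -/
def η {N : ℕ} (α : Fin N) : ℂ :=
  Complex.exp (2 * Real.pi * Complex.I * ((α : ℕ) + 1) / N)

/-- The Haldane--Shastry wave function `∏_{i<j} (z_i - z_j) ^ 2 * ∏_i z_i`, where `z_1, z_2, …`
are the positions of the sites in `A`. -/
def hsWave {N : ℕ} (A : Finset (Fin N)) : ℂ :=
  (∏ i ∈ A, ∏ j ∈ A with i < j, (η i - η j) ^ 2) * ∏ i ∈ A, η i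

/-- The operator `Ψ^HS_0[a†, b†]`: the sum over all sets `A` of `N / 2` sites (`N` even) of
`ψ^HS_0(A)` times the product of the `a†_z` with `z` in `A` and of the `b†_w` with `w` not in
`A`. -/
def hsOp (N : ℕ) : Op N :=
  ∑ A ∈ (Finset.univ : Finset (Fin N)).powersetCard (N / 2),
    hsWave A • (((A.sort (· ≤ ·)).map aDag).prod * ((Aᶜ.sort (· ≤ ·)).map bDag).prod)

/-- The spin liquid state `|ψ^S_0⟩ = (Ψ^HS_0[a†, b†]) ^ (2 S) |0⟩` with `2 S = twoS`. -/
def spinLiquid (N twoS : ℕ) : Fock N := (hsOp N ^ twoS) (vac N)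

/-- The Hamiltonian `H^S` on `N` sites. -/
def hamiltonian (N : ℕ) (S : ℝ) : Op N :=
  ((2 * Real.pi ^ 2 / N ^ 2 : ℝ) : ℂ) •
    ((∑ α : Fin N, ∑ β : Fin N with α ≠ β, ((1 / ‖η α - η β‖ ^ 2 : ℝ) : ℂ) • SS α β)
      - ((1 / (2 * (S + 1) * (2 * S + 3)) : ℝ) : ℂ) •
        ∑ α : Fin N, ∑ β : Fin N with α ≠ β, ∑ γ : Fin N with α ≠ γ,
          (1 / ((conj (η α) - conj (η β)) * (η α - η γ))) •
            (SS α β * SS α γ + SS α γ * SS α β))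

/-- The energy `E^S_0 = -(2 π² / N²) * (S (S + 1)² / (2 S + 3)) * (N (N² + 5) / 12)`. -/
def energy (N : ℕ) (S : ℝ) : ℝ :=
  -(2 * Real.pi ^ 2 / N ^ 2) * (S * (S + 1) ^ 2 / (2 * S + 3)) * (N * (N ^ 2 + 5) / 12)

end SpinChain

end

/-! The whole argument rests on first order differential operators. For weights `c`, write `D_c =
∑_β c_β 𝐒_β`. The operator `twist α c` pairs `D_c` with a quadratic form in the two boson variables
at `α`. It is a derivation, so if it kills the Haldane–Shastry state `Ψ` it kills every power of
`Ψ`; this is how spin `1/2` yields all `S` (`IsLeibniz.pow_apply_eq_zero`).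

For `Ψ` itself, each of the sums over a moved site `β` that is needed evaluates a polynomial of
degree less than `N` without constant term at all `N`-th roots of unity, hence vanishes
(`sum_hsWave_insert`, `sum_gap_mul_hsWave_insert`). So `Ψ` is a singlet, and one component of `twist
α (gap α) Ψ` is zero; raising with the total spin kills the other three (`twist_eq_zero`). The
conjugate weights differ from multiples of `gap α` only by a constant and a term at `α`, both
harmless.

On a state in the spin `S` space killed by `twist α c`, two derivatives at `α` and Euler's identity
turn `𝐒_α (𝐒_α · D_c)` into `(S + 1)` times an expression linear in `𝐒_α`. After symmetrization in
`c, d` the cross products become commutators (`weighted_SS_anticomm`), and the three-site term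
reduces to `D_c · D_d` and `𝐒_α · D_{cd}`. Summing over `α`, `sum_dotSum_eq` expresses the first
kind by the two-site term, the total spin squared (zero on a singlet) and the one-site Casimirs. The
two-site terms cancel exactly with the given coefficient, and the Casimirs are the energy. -/

noncomputable section

namespace SpinChain

open MvPolynomial Finset
open scoped ComplexConjugate

variable {N : ℕ}

/-! ### Bilinears in the bosons and the spin algebra -/

/-- The derivation `X (α, i) ∂ (α, j)`. -/
def hop (α : Fin N) (i j : Fin 2) : Derivation ℂ (Fock N) (Fock N) :=
  (X (α, i) : Fock N) • pderiv (α, j)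

/-- The operator `X (α, i) ∂ (α, j)`. -/
def hopOp (α : Fin N) (i j : Fin 2) : Op N := (hop α i j).toLinearMap

theorem hopOp_apply (α : Fin N) (i j : Fin 2) (f : Fock N) :
    hopOp α i j f = X (α, i) * pderiv (α, j) f := rfl

theorem hopOp_mul (α : Fin N) (i j : Fin 2) (f g : Fock N) :
    hopOp α i j (f * g) = f * hopOp α i j g + g * hopOp α i j f := by
  simp only [hopOp_apply, pderiv_mul]
  ring

theorem pderiv_X_eq_ite (i k : Fin N × Fin 2) :
    pderiv i (X k : Fock N) = if i = k then 1 else 0 := by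
  by_cases h : i = k
  · simp [h]
  · rw [pderiv_X_of_ne (Ne.symm h), if_neg h]

theorem pderiv_comm_apply (i j : Fin N × Fin 2) (f : Fock N) :
    pderiv i (pderiv j f) = pderiv j (pderiv i f) := by
  have h : ⁅(pderiv i : Derivation ℂ (Fock N) (Fock N)),
      (pderiv j : Derivation ℂ (Fock N) (Fock N))⁆ = 0 := by
    refine derivation_ext fun k => ?_
    rw [Derivation.commutator_apply, pderiv_X_eq_ite, pderiv_X_eq_ite, Derivation.zero_apply]
    split_ifs <;> simp
  have h2 := congrArg (fun D => D f) h
  simpa [Derivation.commutator_apply, sub_eq_zero] using h2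

theorem hopOp_mul_hopOp (α β : Fin N) (i j k l : Fin 2) :
    hopOp α i j * hopOp β k l = hopOp β k l * hopOp α i j +
      (if α = β ∧ j = k then hopOp α i l else 0) -
      (if α = β ∧ i = l then hopOp α k j else 0) := by
  refine LinearMap.ext fun f => ?_
  have h1 : pderiv (α, j) (X (β, k) : Fock N) = if α = β ∧ j = k then 1 else 0 :=
    (pderiv_X_eq_ite _ _).trans (if_congr (by rw [Prod.mk.injEq]) rfl rfl)
  have h2 : pderiv (β, l) (X (α, i) : Fock N) = if α = β ∧ i = l then 1 else 0 :=
    (pderiv_X_eq_ite _ _).trans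
      (if_congr (by rw [Prod.mk.injEq, eq_comm, eq_comm (a := l)]) rfl rfl)
  have h3 : (if α = β ∧ j = k then hopOp α i l else 0 : Op N) f =
      (if α = β ∧ j = k then 1 else 0) * (X (α, i) * pderiv (β, l) f) := by
    split_ifs with c
    · obtain ⟨rfl, rfl⟩ := c; rw [one_mul, hopOp_apply]
    · rw [zero_mul, LinearMap.zero_apply]
  have h4 : (if α = β ∧ i = l then hopOp α k j else 0 : Op N) f =
      (if α = β ∧ i = l then 1 else 0) * (X (β, k) * pderiv (α, j) f) := by
    split_ifs with c
    · obtain ⟨rfl, rfl⟩ := c; rw [one_mul, hopOp_apply]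
    · rw [zero_mul, LinearMap.zero_apply]
  rw [LinearMap.sub_apply, LinearMap.add_apply, h3, h4]
  simp only [Module.End.mul_apply, hopOp_apply, pderiv_mul, h1, h2,
    pderiv_comm_apply (β, l) (α, j)]
  ring

theorem hopOp_mul_hopOp_of_ne {α β : Fin N} (h : α ≠ β) (i j k l : Fin 2) :
    hopOp α i j * hopOp β k l = hopOp β k l * hopOp α i j := by
  rw [hopOp_mul_hopOp, if_neg (fun c => h c.1), if_neg (fun c => h c.1), add_zero, sub_zero]

/-- `S^+_α = a† b` -/
def raise (α : Fin N) : Op N := hopOp α 0 1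

/-- `S^-_α = b† a` -/
def lower (α : Fin N) : Op N := hopOp α 1 0

/-- The number of bosons at a site. -/
def number (α : Fin N) : Op N := hopOp α 0 0 + hopOp α 1 1

theorem raise_eq (α : Fin N) : aDag α * bOp α = raise α := rfl
theorem lower_eq (α : Fin N) : bDag α * aOp α = lower α := rfl
theorem number_eq (α : Fin N) : aDag α * aOp α + bDag α * bOp α = number α := rfl
theorem Sz_eq (α : Fin N) : Sz α = (1 / 2 : ℂ) • (hopOp α 0 0 - hopOp α 1 1) := rfl

theorem raise_mul_lower (α β : Fin N) :
    raise α * lower β = lower β * raise α + if α = β then (2 : ℂ) • Sz α else 0 := by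
  by_cases h : α = β
  · subst h
    rw [raise, lower, hopOp_mul_hopOp, Sz_eq]
    simp [smul_smul, add_sub_assoc]
  · rw [raise, lower, hopOp_mul_hopOp_of_ne h, if_neg h, add_zero]

theorem Sz_mul_raise (α β : Fin N) :
    Sz α * raise β = raise β * Sz α + if α = β then raise α else 0 := by
  rw [raise, raise, Sz_eq, smul_mul_assoc, mul_smul_comm, sub_mul, mul_sub]
  by_cases h : α = β
  · subst h
    rw [hopOp_mul_hopOp α α 0 0, hopOp_mul_hopOp α α 1 1]
    simp
    module
  · rw [hopOp_mul_hopOp_of_ne h, hopOp_mul_hopOp_of_ne h, if_neg h, add_zero]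

theorem Sz_mul_lower (α β : Fin N) :
    Sz α * lower β = lower β * Sz α - if α = β then lower α else 0 := by
  rw [lower, lower, Sz_eq, smul_mul_assoc, mul_smul_comm, sub_mul, mul_sub]
  by_cases h : α = β
  · subst h
    rw [hopOp_mul_hopOp α α 0 0, hopOp_mul_hopOp α α 1 1]
    simp
    module
  · rw [hopOp_mul_hopOp_of_ne h, hopOp_mul_hopOp_of_ne h, if_neg h, sub_zero]

theorem raise_mul_raise (α β : Fin N) : raise α * raise β = raise β * raise α := by
  rw [raise, raise, hopOp_mul_hopOp]; simp

theorem hopOp_self_mul_hopOp_self (α β : Fin N) (i j : Fin 2) :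
    hopOp α i i * hopOp β j j = hopOp β j j * hopOp α i i := by
  rw [hopOp_mul_hopOp]
  by_cases h : α = β ∧ i = j
  · obtain ⟨rfl, rfl⟩ := h; simp
  · simp only [h, if_false, add_zero, sub_zero]

theorem Sz_mul_Sz (α β : Fin N) : Sz α * Sz β = Sz β * Sz α := by
  simp only [Sz_eq, smul_mul_assoc, mul_smul_comm, sub_mul, mul_sub,
    hopOp_self_mul_hopOp_self α β]
  module

theorem number_mul_hopOp (α β : Fin N) (i j : Fin 2) :
    number α * hopOp β i j = hopOp β i j * number α := by
  rw [number, add_mul, mul_add]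
  by_cases h : α = β
  · subst h
    rw [hopOp_mul_hopOp α α 0 0, hopOp_mul_hopOp α α 1 1]
    fin_cases i <;> fin_cases j <;> simp
  · rw [hopOp_mul_hopOp_of_ne h, hopOp_mul_hopOp_of_ne h]

theorem commute_number_raise (α β : Fin N) : Commute (number α) (raise β) :=
  number_mul_hopOp α β 0 1

theorem commute_number_lower (α β : Fin N) : Commute (number α) (lower β) :=
  number_mul_hopOp α β 1 0

theorem commute_number_Sz (α β : Fin N) : Commute (number α) (Sz β) :=
  (Commute.sub_right (number_mul_hopOp α β 0 0) (number_mul_hopOp α β 1 1)).smul_right _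

theorem SS_eq (α β : Fin N) :
    SS α β = Sz α * Sz β + (1 / 2 : ℂ) • (raise α * lower β + lower α * raise β) := by
  have h : (1 / (2 * Complex.I) : ℂ) * (1 / (2 * Complex.I)) = -(1 / 4) := by
    field_simp
    norm_num
  rw [SS, Sx, Sy, Sx, Sy, raise_eq, lower_eq, raise_eq, lower_eq]
  generalize raise α = a, raise β = b, lower α = c, lower β = d, Sz α * Sz β = e
  rw [smul_mul_smul_comm, smul_mul_smul_comm, h, add_mul, mul_add, mul_add, sub_mul, mul_sub,
    mul_sub]
  module

theorem SS_comm (α β : Fin N) : SS α β = SS β α := by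
  rw [SS_eq, SS_eq, Sz_mul_Sz, raise_mul_lower α β, raise_mul_lower β α]
  by_cases h : α = β
  · subst h; rfl
  · simp only [h, Ne.symm h, if_false, add_zero]; rw [add_comm (lower β * _)]

theorem commute_number_SS (α β γ : Fin N) : Commute (number α) (SS β γ) := by
  rw [SS_eq]
  have h1 := (commute_number_Sz α β).mul_right (commute_number_Sz α γ)
  have h2 := (commute_number_raise α β).mul_right (commute_number_lower α γ)
  have h3 := (commute_number_lower α β).mul_right (commute_number_raise α γ)
  exact h1.add_right ((h2.add_right h3).smul_right _)

theorem mem_spinSpace {k : ℕ} {f : Fock N} :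
    f ∈ spinSpace N k ↔ ∀ α, number α f = (k : ℂ) • f := by
  simp only [spinSpace, Submodule.mem_iInf, Module.End.mem_eigenspace_iff, number_eq]

/-- The Casimir `S (S + 1)` with `S = n / 2`, as an operator identity in the number operator `n`. -/
theorem SS_self (α : Fin N) :
    SS α α = (1 / 4 : ℂ) • (number α * number α + (2 : ℂ) • number α) := by
  have key : hopOp α 1 0 * hopOp α 0 1 = hopOp α 1 1 * hopOp α 0 0 + hopOp α 1 1 := by
    refine LinearMap.ext fun f => ?_
    simp only [Module.End.mul_apply, LinearMap.add_apply, hopOp_apply, pderiv_mul,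
      pderiv_X_eq_ite]
    simp [pderiv_comm_apply (α, 0) (α, 1)]
    ring
  rw [SS_eq, raise_mul_lower, if_pos rfl, raise, lower, Sz_eq, number, key,
    smul_mul_smul_comm, sub_mul, mul_sub, mul_sub, add_mul, mul_add, mul_add,
    hopOp_self_mul_hopOp_self α α 0 1]
  module

theorem SS_self_apply {k : ℕ} {f : Fock N} (hf : f ∈ spinSpace N k) (α : Fin N) :
    SS α α f = ((k / 2 : ℂ) * (k / 2 + 1)) • f := by
  have h1 := mem_spinSpace.1 hf α
  rw [SS_self]
  simp only [LinearMap.smul_apply, LinearMap.add_apply, Module.End.mul_apply, h1, map_smul]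
  module

/-! ### Roots of unity -/

theorem eta_eq_pow (α : Fin N) :
    η α = Complex.exp (2 * Real.pi * Complex.I / N) ^ ((α : ℕ) + 1) := by
  rw [η, ← Complex.exp_nat_mul]
  congr 1
  push_cast
  ring

theorem eta_pow_card (α : Fin N) : η α ^ N = 1 := by
  have hN : N ≠ 0 := by have := α.2; omega
  rw [eta_eq_pow, ← pow_mul, mul_comm (_ + 1) N, pow_mul, (Complex.isPrimitiveRoot_exp N hN).pow_eq_one,
    one_pow]

theorem eta_ne_zero (α : Fin N) : η α ≠ 0 := Complex.exp_ne_zero _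

theorem eta_injective : Function.Injective (η : Fin N → ℂ) := by
  intro α β h
  have hN : N ≠ 0 := by have := α.2; omega
  have h0 := Complex.exp_ne_zero (2 * Real.pi * Complex.I / N)
  rw [eta_eq_pow, eta_eq_pow, pow_succ, pow_succ] at h
  exact Fin.ext ((Complex.isPrimitiveRoot_exp N hN).pow_inj α.2 β.2 (mul_right_cancel₀ h0 h))

theorem conj_eta (α : Fin N) : conj (η α) = (η α)⁻¹ := by
  rw [η, ← Complex.exp_conj, ← Complex.exp_neg]
  congr 1
  simp [neg_div, Complex.conj_ofNat]

theorem sum_eta_pow {j : ℕ} (hj : j ≠ 0) (hjN : j < N) : ∑ α : Fin N, η α ^ j = 0 := by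
  have hN : N ≠ 0 := by omega
  have hζ := Complex.isPrimitiveRoot_exp N hN
  set ζ := Complex.exp (2 * Real.pi * Complex.I / N)
  have h1 : ∀ α : Fin N, η α ^ j = ζ ^ j * (ζ ^ j) ^ (α : ℕ) := by
    intro α
    rw [eta_eq_pow, ← pow_mul, ← pow_mul, ← pow_add]
    congr 1
    ring
  simp only [h1]
  rw [← mul_sum, Fin.sum_univ_eq_sum_range (fun i => (ζ ^ j) ^ i),
    geom_sum_eq (hζ.pow_ne_one_of_pos_of_lt hj hjN), ← pow_mul, mul_comm j, pow_mul,
    hζ.pow_eq_one, one_pow, sub_self, zero_div, mul_zero]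

/-- Only exponents divisible by `N` survive the sum over all roots; below degree `N` that leaves the
constant term. -/
theorem sum_eval_eta {p : Polynomial ℂ} (hp : p.natDegree < N) (h0 : p.coeff 0 = 0) :
    ∑ α : Fin N, p.eval (η α) = 0 := by
  simp only [Polynomial.eval_eq_sum_range' hp]
  rw [sum_comm]
  refine sum_eq_zero fun j hj => ?_
  rw [← mul_sum]
  by_cases h : j = 0
  · rw [h, h0, zero_mul]
  · rw [sum_eta_pow h (mem_range.1 hj), mul_zero]

/-! ### Lattice sums of inverse differences -/

/-- The inverse difference of the positions of two sites; it is `0` for equal sites. -/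
def gap (α β : Fin N) : ℂ := 1 / (η α - η β)

@[simp] theorem gap_self (α : Fin N) : gap α α = 0 := by simp [gap]

theorem gap_comm (α β : Fin N) : gap α β = -gap β α := by
  rw [gap, gap, ← neg_sub, one_div, one_div, inv_neg]

theorem gap_mul {α β : Fin N} (h : α ≠ β) : gap α β * (η α - η β) = 1 :=
  one_div_mul_cancel (sub_ne_zero.2 (eta_injective.ne h))

theorem conj_gap (α β : Fin N) : conj (gap α β) = -(η α * η β * gap α β) := by
  by_cases h : α = β
  · subst h; simp
  · have h1 := sub_ne_zero.2 (eta_injective.ne h)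
    have h2 := sub_ne_zero.2 (eta_injective.ne (Ne.symm h))
    have ha := eta_ne_zero α
    have hb := eta_ne_zero β
    rw [gap, map_div₀, map_one, map_sub, conj_eta, conj_eta]
    have h3 : (η α)⁻¹ - (η β)⁻¹ = -(η α - η β) / (η α * η β) := by
      field_simp
      ring
    rw [h3]
    field_simp

theorem sub_mul_sum_mul_pow (y : ℂ) (n : ℕ) :
    (1 - y) * ∑ k ∈ range n, (k : ℂ) * y ^ k + n * y ^ n = ∑ k ∈ range n, y ^ (k + 1) := by
  induction n with
  | zero => simp
  | succ n ih =>
    rw [sum_range_succ, sum_range_succ, ← ih]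
    push_cast
    ring

/-- A finite Fourier expansion. Its right side is not zero at `α = β`, and that defect is the entire
value of `sum_eta_mul_gap`. -/
theorem eta_mul_gap {α β : Fin N} (h : α ≠ β) :
    η β * gap α β = (1 / N : ℂ) * ∑ k ∈ range N, (k : ℂ) * (η α / η β) ^ k := by
  have hb := eta_ne_zero β
  have hN : (N : ℂ) ≠ 0 := by
    have := α.2
    exact_mod_cast (by omega : N ≠ 0)
  have hy : η α / η β ≠ 1 := fun hy => h (eta_injective ((div_eq_one_iff_eq hb).1 hy))
  have hyN : (η α / η β) ^ N = 1 := by rw [div_pow, eta_pow_card, eta_pow_card, div_one]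
  have h1 := sub_mul_sum_mul_pow (η α / η β) N
  have h2 : ∑ k ∈ range N, (η α / η β) ^ (k + 1) = 0 := by
    simp only [pow_succ]
    rw [← sum_mul, geom_sum_eq hy, hyN, sub_self, zero_div, zero_mul]
  rw [h2, hyN] at h1
  have h3 := gap_mul h
  generalize (∑ k ∈ range N, (k : ℂ) * (η α / η β) ^ k) = s at h1 ⊢
  field_simp at h1 ⊢
  linear_combination gap α β * h1 + s * h3

theorem sum_eta_mul_gap (β : Fin N) : ∑ α, η β * gap α β = -((N : ℂ) - 1) / 2 := by
  have hb := eta_ne_zero β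
  have hN0 : N ≠ 0 := by have := β.2; omega
  have hN : (N : ℂ) ≠ 0 := by exact_mod_cast hN0
  have h1 : ∀ α : Fin N, η β * gap α β =
      (1 / N : ℂ) * ∑ k ∈ range N, (k : ℂ) * (η α / η β) ^ k
        - if α = β then (1 / N : ℂ) * ∑ k ∈ range N, (k : ℂ) else 0 := by
    intro α
    by_cases h : α = β
    · subst h; simp [div_self hb]
    · rw [eta_mul_gap h, if_neg h, sub_zero]
  have h2 : ∑ α : Fin N, ∑ k ∈ range N, (k : ℂ) * (η α / η β) ^ k = 0 := by
    rw [sum_comm]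
    refine sum_eq_zero fun k hk => ?_
    by_cases h : k = 0
    · subst h; simp
    · simp only [div_pow]
      rw [← mul_sum, ← sum_div, sum_eta_pow h (mem_range.1 hk), zero_div, mul_zero]
  have h3 : (∑ k ∈ range N, (k : ℂ)) * 2 = N * (N - 1) := by
    have h := Finset.sum_range_id_mul_two N
    have h' := congrArg (Nat.cast (R := ℂ)) h
    push_cast [Nat.cast_sub (Nat.one_le_iff_ne_zero.2 hN0)] at h'
    exact h'
  simp only [h1]
  rw [sum_sub_distrib, ← mul_sum, h2, sum_ite_eq' univ β, if_pos (mem_univ _)]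
  field_simp
  linear_combination -h3

theorem sum_eta_mul_gap' (β : Fin N) : ∑ α, η α * gap α β = ((N : ℂ) - 1) / 2 := by
  have h1 : ∀ α : Fin N, η α * gap α β = η β * gap α β + 1 - if α = β then 1 else 0 := by
    intro α
    by_cases h : α = β
    · subst h; simp
    · rw [if_neg h]; linear_combination gap_mul h
  simp only [h1]
  rw [sum_sub_distrib, sum_add_distrib, sum_eta_mul_gap, sum_ite_eq' univ β,
    if_pos (mem_univ _)]
  simp
  ring

/-- The sum over `α` of the coefficients of the three-site terms. -/
def triple (β γ : Fin N) : ℂ := ∑ α, conj (gap α β) * gap α γ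

/-- Partial fractions; the extra terms compensate for the convention `gap α α = 0`. -/
theorem gap_mul_gap {β γ : Fin N} (h : β ≠ γ) (α : Fin N) :
    gap α β * gap α γ = gap β γ * (gap α β - gap α γ)
      + if α = β then gap β γ ^ 2 else 0 + if α = γ then gap β γ ^ 2 else 0 := by
  by_cases h1 : α = β
  · subst h1; simp; ring
  by_cases h2 : α = γ
  · subst h2; simp [h1, gap_comm β α]; ring
  simp only [h1, h2, if_false]
  linear_combination (-gap α β * gap α γ) * gap_mul h - (gap β γ * gap α γ) * gap_mul h1
    + (gap β γ * gap α β) * gap_mul h2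

theorem triple_of_ne {β γ : Fin N} (h : β ≠ γ) :
    triple β γ = -(η β * (η β + η γ) * gap β γ ^ 2) := by
  have h1 : ∀ α, conj (gap α β) * gap α γ = -η β * (gap β γ * (η α * gap α β - η α * gap α γ)
      + ((if α = β then η β * gap β γ ^ 2 else 0) +
        if α = γ then η γ * gap β γ ^ 2 else 0)) := by
    intro α
    have e1 : (if α = β then η β * gap β γ ^ 2 else 0) =
        η α * if α = β then gap β γ ^ 2 else 0 := by
      split_ifs with c
      · rw [c]
      · rw [mul_zero]
    have e2 : (if α = γ then η γ * gap β γ ^ 2 else 0) =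
        η α * if α = γ then gap β γ ^ 2 else 0 := by
      split_ifs with c
      · rw [c]
      · rw [mul_zero]
    have e3 := gap_mul_gap h α
    rw [conj_gap, e1, e2]
    by_cases c1 : α = β
    · have c2 : α ≠ γ := fun c => h (c1.symm.trans c)
      simp only [c1, if_true, h, if_false] at e3 ⊢
      linear_combination (-η β * η β) * e3
    · simp only [c1, if_false] at e3 ⊢
      linear_combination (-η α * η β) * e3
  simp only [triple, h1]
  rw [← mul_sum, sum_add_distrib, sum_add_distrib, ← mul_sum, sum_sub_distrib,
    sum_eta_mul_gap', sum_eta_mul_gap', sum_ite_eq' univ β, sum_ite_eq' univ γ,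
    if_pos (mem_univ _), if_pos (mem_univ _)]
  ring

/-- Off the diagonal this is `(η β + η γ)² = (η β - η γ)² + 4 η β η γ` together with `|gap|² = -η β
η γ gap²`. It is what turns three-site coefficients into two-site ones. -/
theorem triple_add_triple (β γ : Fin N) :
    triple β γ + triple γ β = 4 * (conj (gap β γ) * gap β γ) - 1 +
      if β = γ then 2 * triple β β + 1 else 0 := by
  by_cases h : β = γ
  · subst h; simp; ring
  · rw [if_neg h, triple_of_ne h, triple_of_ne (Ne.symm h), conj_gap, gap_comm γ β]
    linear_combination (-(gap β γ * (η β - η γ)) - 1) * gap_mul h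

/-- Double counting: the sum over all pairs `β, γ` factors for each `α`, while `triple_add_triple`
expresses it by the diagonal sum `T`, which gives a linear equation `6 T = …`. -/
theorem sum_triple_self : ∑ β : Fin N, triple β β = (N : ℂ) * (N ^ 2 - 1) / 12 := by
  have h1 : ∑ β : Fin N, ∑ γ : Fin N, triple β γ = N * ((N - 1) / 2 * ((N - 1) / 2)) := by
    have e : ∑ β : Fin N, ∑ γ : Fin N, triple β γ =
        ∑ α : Fin N, (∑ β, conj (gap α β)) * ∑ γ, gap α γ := by
      simp only [triple, sum_mul_sum]
      rw [sum_comm_cycle]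
    have e2 : ∀ α : Fin N, η α * ∑ γ, gap α γ = (N - 1) / 2 := by
      intro α
      rw [mul_sum]
      simp only [gap_comm α, mul_neg, sum_neg_distrib]
      rw [sum_eta_mul_gap]
      ring
    have e3 : ∀ α : Fin N, ∑ β, conj (gap α β) = η α * ((N - 1) / 2) := by
      intro α
      have : ∀ β, conj (gap α β) = η α * (η β * gap β α) := by
        intro β
        rw [conj_gap, gap_comm α β]
        ring
      simp only [this]
      rw [← mul_sum, sum_eta_mul_gap']
    have e4 : ∀ α : Fin N, (∑ β, conj (gap α β)) * ∑ γ, gap α γ =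
        (N - 1) / 2 * ((N - 1) / 2) := by
      intro α
      rw [e3]
      linear_combination ((N - 1) / 2 : ℂ) * e2 α
    rw [e, sum_congr rfl fun α _ => e4 α]
    simp
  have h2 : ∑ β : Fin N, ∑ γ : Fin N, (triple β γ + triple γ β) =
      2 * ∑ β : Fin N, ∑ γ : Fin N, triple β γ := by
    simp only [sum_add_distrib]
    rw [sum_comm (f := fun β γ => triple γ β)]
    ring
  have h3 : ∑ β : Fin N, ∑ γ : Fin N, conj (gap β γ) * gap β γ = ∑ β : Fin N, triple β β := by
    rw [sum_comm]
    rfl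
  simp only [triple_add_triple, sum_add_distrib, sum_sub_distrib, ← mul_sum, h3, h1,
    sum_ite_eq, mem_univ, if_true] at h2
  simp at h2
  linear_combination (1 / 6 : ℂ) * h2

/-! ### The Haldane–Shastry wave function -/

theorem prod_lt_insert {ι M : Type*} [LinearOrder ι] [CommMonoid M] (f : ι → ι → M)
    (hf : ∀ i j, f i j = f j i) {b : ι} {B : Finset ι} (hb : b ∉ B) :
    ∏ i ∈ insert b B, ∏ j ∈ insert b B with i < j, f i j =
      (∏ i ∈ B, ∏ j ∈ B with i < j, f i j) * ∏ j ∈ B, f b j := by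
  simp only [prod_filter, prod_insert hb, lt_irrefl, if_false, one_mul, prod_mul_distrib]
  rw [← mul_assoc, ← prod_mul_distrib, mul_comm]
  congr 1
  refine prod_congr rfl fun j hj => ?_
  have hne : b ≠ j := fun h => hb (h ▸ hj)
  rcases lt_or_gt_of_ne hne with h | h
  · rw [if_pos h, if_neg h.not_gt, mul_one]
  · rw [if_neg h.not_gt, if_pos h, one_mul, hf]

theorem hsWave_insert {β : Fin N} {B : Finset (Fin N)} (hβ : β ∉ B) :
    hsWave (insert β B) = hsWave B * (η β * ∏ j ∈ B, (η β - η j) ^ 2) := by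
  rw [hsWave, hsWave, prod_lt_insert (fun i j => (η i - η j) ^ 2) (fun i j => by ring) hβ,
    prod_insert hβ]
  ring

theorem hsWave_ne_zero (A : Finset (Fin N)) : hsWave A ≠ 0 := by
  refine mul_ne_zero (prod_ne_zero_iff.2 fun i _ => prod_ne_zero_iff.2 fun j hj => ?_)
    (prod_ne_zero_iff.2 fun i _ => eta_ne_zero i)
  exact pow_ne_zero _ (sub_ne_zero.2 (eta_injective.ne (mem_filter.1 hj).2.ne))

theorem hsWave_eq (A : Finset (Fin N)) :
    hsWave A = (∏ k ∈ range #A, (-1 : ℂ) ^ k) *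
      ((∏ i ∈ A, ∏ j ∈ A.erase i, (η i - η j)) * ∏ i ∈ A, η i) := by
  induction A using Finset.induction_on with
  | empty => simp [hsWave]
  | insert β B hβ ih =>
    have h1 : ∏ i ∈ insert β B, ∏ j ∈ (insert β B).erase i, (η i - η j : ℂ) =
        (∏ j ∈ B, (η β - η j)) * ((∏ i ∈ B, (η i - η β)) *
          ∏ i ∈ B, ∏ j ∈ B.erase i, (η i - η j)) := by
      rw [prod_insert hβ, erase_insert hβ]
      congr 1
      rw [← prod_mul_distrib]
      refine prod_congr rfl fun i hi => ?_
      have hne : i ≠ β := fun h => hβ (h ▸ hi)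
      rw [erase_insert_of_ne hne.symm, prod_insert (fun h => hβ (mem_of_mem_erase h))]
    have h2 : ∏ i ∈ B, (η i - η β) = (-1) ^ #B * ∏ i ∈ B, (η β - η i) := by
      rw [← prod_const, ← prod_mul_distrib]
      exact prod_congr rfl fun i _ => by ring
    have h3 : ((-1 : ℂ) ^ #B) * (-1) ^ #B = 1 := by rw [← mul_pow]; simp
    rw [hsWave_insert hβ, ih, h1, h2, card_insert_of_notMem hβ, prod_range_succ,
      prod_insert hβ, prod_pow]
    generalize (∏ k ∈ range #B, (-1 : ℂ) ^ k) = s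
    generalize (∏ i ∈ B, ∏ j ∈ B.erase i, (η i - η j)) = d
    generalize (∏ i ∈ B, (η β - η i)) = e
    generalize (∏ i ∈ B, η i) = f
    linear_combination (-(s * d * f * η β * e ^ 2)) * h3

/-- The derivative of `X ^ N - 1 = ∏ (X - η β)` at the root `η α`. -/
theorem prod_erase_eta (α : Fin N) : ∏ β ∈ univ.erase α, (η α - η β) = N * (η α)⁻¹ := by
  have hN0 : N ≠ 0 := by have := α.2; omega
  have h1 : Lagrange.nodal univ (η : Fin N → ℂ) = Polynomial.X ^ N - 1 := by
    refine Polynomial.eq_of_degree_sub_lt_of_eval_index_eq (s := (univ : Finset (Fin N)))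
      (v := η) (eta_injective.injOn) ?_ ?_
    · rw [← Lagrange.degree_nodal (s := univ) (v := (η : Fin N → ℂ))]
      refine Polynomial.degree_sub_lt_left ?_ Lagrange.nodal_ne_zero ?_
      · rw [Lagrange.degree_nodal, ← Polynomial.C_1,
          Polynomial.degree_X_pow_sub_C (by omega) (1 : ℂ)]
        simp
      · rw [Lagrange.nodal_monic, Polynomial.leadingCoeff_X_pow_sub_one (by omega)]
    · intro i _
      rw [Lagrange.eval_nodal_at_node (mem_univ i)]
      simp [eta_pow_card]
  have h2 := Lagrange.eval_nodal_derivative_eval_node_eq (s := univ) (v := (η : Fin N → ℂ))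
    (mem_univ α)
  rw [h1, Lagrange.eval_nodal] at h2
  rw [← h2]
  have h3 : η α ^ (N - 1) * η α = 1 := by
    rw [← pow_succ, Nat.sub_add_cancel (by omega), eta_pow_card]
  rw [← eq_inv_of_mul_eq_one_left h3]
  simp [Polynomial.derivative_X_pow]

/-- For `i ∈ A`, the differences to `A` and to its complement combine to `N / η i`, which cancels
the factor `η i`. Only the size of `A` remains, whence the spin flip symmetry `hsWave_compl`. -/
theorem hsWave_mul_prod (A : Finset (Fin N)) :
    hsWave A * ∏ i ∈ A, ∏ j ∈ Aᶜ, (η i - η j) =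
      (∏ k ∈ range #A, (-1 : ℂ) ^ k) * (N : ℂ) ^ #A := by
  rw [hsWave_eq, mul_assoc]
  congr 1
  rw [mul_right_comm, ← prod_mul_distrib, ← prod_mul_distrib, ← prod_const]
  refine prod_congr rfl fun i hi => ?_
  have h : univ.erase i = A.erase i ∪ Aᶜ := by
    ext j
    by_cases hj : j ∈ A <;> simp [hj]
    rintro rfl
    exact hj hi
  rw [← prod_union, ← h, prod_erase_eta, mul_assoc, inv_mul_cancel₀ (eta_ne_zero i), mul_one]
  exact disjoint_compl_right.mono_left (erase_subset _ _)

theorem hsWave_compl {A : Finset (Fin N)} (hA : #Aᶜ = #A) :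
    hsWave Aᶜ = (-1) ^ #A * hsWave A := by
  have h1 := hsWave_mul_prod A
  have h2 := hsWave_mul_prod Aᶜ
  rw [hA, compl_compl, ← h1] at h2
  have h3 : ∏ i ∈ Aᶜ, ∏ j ∈ A, (η i - η j) =
      (-1) ^ #A * ∏ i ∈ A, ∏ j ∈ Aᶜ, (η i - η j) := by
    have h4 : ((-1 : ℂ) ^ #A) ^ #A = (-1) ^ #A := by
      rw [← pow_mul]
      rcases Nat.even_or_odd (#A) with h | h
      · rw [h.neg_one_pow, (h.mul_left _).neg_one_pow]
      · rw [h.neg_one_pow, (h.mul h).neg_one_pow]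
    rw [prod_comm, ← h4, ← prod_const, ← prod_mul_distrib]
    refine prod_congr rfl fun i _ => ?_
    rw [← hA, ← prod_const, ← prod_mul_distrib]
    exact prod_congr rfl fun j _ => by ring
  have h5 : ∏ i ∈ A, ∏ j ∈ Aᶜ, (η i - η j) ≠ 0 := by
    refine prod_ne_zero_iff.2 fun i hi => prod_ne_zero_iff.2 fun j hj => ?_
    exact sub_ne_zero.2 (eta_injective.ne fun h => (mem_compl.1 hj) (h ▸ hi))
  rw [h3] at h2
  have h6 : ((-1 : ℂ) ^ #A) * (-1) ^ #A = 1 := by rw [← mul_pow]; simp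
  refine mul_right_cancel₀ h5 ?_
  linear_combination ((-1 : ℂ) ^ #A) * h2 -
    (hsWave Aᶜ * ∏ i ∈ A, ∏ j ∈ Aᶜ, (η i - η j)) * h6

/-- In the position of `β` the summand is a polynomial of degree `2 #B + 1` with no constant term;
its double zeros at `B` make the case distinction automatic. -/
theorem sum_hsWave_insert (B : Finset (Fin N)) (hB : 2 * #B + 1 < N) :
    ∑ β, (if β ∈ B then 0 else hsWave (insert β B)) = 0 := by
  set p : Polynomial ℂ := Polynomial.X * ∏ j ∈ B, (Polynomial.X - Polynomial.C (η j)) ^ 2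
    with hp
  have hev : ∀ β, (if β ∈ B then 0 else hsWave (insert β B)) = hsWave B * p.eval (η β) := by
    intro β
    rw [hp, Polynomial.eval_mul, Polynomial.eval_X, Polynomial.eval_prod]
    simp only [Polynomial.eval_pow, Polynomial.eval_sub, Polynomial.eval_X, Polynomial.eval_C]
    split_ifs with h
    · rw [prod_eq_zero h (by simp), mul_zero, mul_zero]
    · exact hsWave_insert h
  simp only [hev]
  rw [← mul_sum, sum_eval_eta, mul_zero]
  · refine lt_of_le_of_lt ?_ hB
    refine Polynomial.natDegree_mul_le.trans ?_
    rw [Polynomial.natDegree_X, add_comm]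
    refine Nat.add_le_add_right ((Polynomial.natDegree_prod_le _ _).trans ?_) 1
    rw [mul_comm, ← smul_eq_mul, ← sum_const]
    refine sum_le_sum fun j _ => Polynomial.natDegree_pow_le.trans ?_
    rw [Polynomial.natDegree_X_sub_C]
  · simp [hp]

/-- Since `α ∈ B`, the weight cancels one of the two zeros at `η α`: still a polynomial vanishing on
`B`, now of degree `2 #B`. -/
theorem sum_gap_mul_hsWave_insert {α : Fin N} {B : Finset (Fin N)} (hα : α ∈ B)
    (hB : 2 * #B + 1 ≤ N) :
    ∑ β, (if β ∈ B then 0 else gap α β * hsWave (insert β B)) = 0 := by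
  set p : Polynomial ℂ := Polynomial.X * ((Polynomial.X - Polynomial.C (η α)) *
    ∏ j ∈ B.erase α, (Polynomial.X - Polynomial.C (η j)) ^ 2) with hp
  have hev : ∀ β, (if β ∈ B then 0 else gap α β * hsWave (insert β B)) =
      -hsWave B * p.eval (η β) := by
    intro β
    rw [hp, Polynomial.eval_mul, Polynomial.eval_mul, Polynomial.eval_X, Polynomial.eval_prod]
    simp only [Polynomial.eval_pow, Polynomial.eval_sub, Polynomial.eval_X, Polynomial.eval_C]
    split_ifs with h
    · by_cases hβ : β = α
      · rw [hβ]; ring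
      · rw [prod_eq_zero (mem_erase.2 ⟨hβ, h⟩) (by simp)]; ring
    · have hne : α ≠ β := fun e => h (e ▸ hα)
      rw [hsWave_insert h, ← mul_prod_erase B _ hα]
      generalize ∏ j ∈ B.erase α, (η β - η j) ^ 2 = q
      linear_combination (-hsWave B * η β * q * (η β - η α)) * gap_mul hne
  simp only [hev]
  have hcard := card_erase_add_one hα
  rw [← mul_sum, sum_eval_eta, mul_zero]
  · refine lt_of_lt_of_le ?_ hB
    have h1 : (∏ j ∈ B.erase α, (Polynomial.X - Polynomial.C (η j)) ^ 2).natDegree ≤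
        2 * #(B.erase α) := by
      refine (Polynomial.natDegree_prod_le _ _).trans ?_
      rw [mul_comm, ← smul_eq_mul, ← sum_const]
      refine sum_le_sum fun j _ => Polynomial.natDegree_pow_le.trans ?_
      rw [Polynomial.natDegree_X_sub_C]
    have h2 := Polynomial.natDegree_mul_le (p := Polynomial.X - Polynomial.C (η α))
      (q := ∏ j ∈ B.erase α, (Polynomial.X - Polynomial.C (η j)) ^ 2)
    have h3 := Polynomial.natDegree_mul_le (p := Polynomial.X)
      (q := (Polynomial.X - Polynomial.C (η α)) *
        ∏ j ∈ B.erase α, (Polynomial.X - Polynomial.C (η j)) ^ 2)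
    rw [Polynomial.natDegree_X] at h3
    rw [Polynomial.natDegree_X_sub_C] at h2
    rw [hp]
    omega
  · simp [hp]

/-! ### Contraction identities at a single site -/

theorem pderiv_site (α : Fin N) :
    pderiv (α, 0) (X (α, 0) : Fock N) = 1 ∧ pderiv (α, 0) (X (α, 1) : Fock N) = 0 ∧
      pderiv (α, 1) (X (α, 0) : Fock N) = 0 ∧ pderiv (α, 1) (X (α, 1) : Fock N) = 1 := by
  simp

theorem euler {α : Fin N} {k : ℂ} {u : Fock N} (hu : number α u = k • u) :
    X (α, 0) * pderiv (α, 0) u + X (α, 1) * pderiv (α, 1) u = C k * u := by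
  rw [← smul_eq_C_mul, ← hu]
  rfl

theorem euler_zero {α : Fin N} {k : ℂ} {u : Fock N} (hu : number α u = k • u) :
    X (α, 0) * pderiv (α, 0) (pderiv (α, 0) u) + X (α, 1) * pderiv (α, 0) (pderiv (α, 1) u) =
      (C k - 1) * pderiv (α, 0) u := by
  have h := congrArg (pderiv (α, 0)) (euler hu)
  obtain ⟨h1, h2, -, -⟩ := pderiv_site α
  simp only [map_add, pderiv_mul, pderiv_C, h1, h2] at h
  linear_combination h

theorem euler_one {α : Fin N} {k : ℂ} {u : Fock N} (hu : number α u = k • u) :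
    X (α, 0) * pderiv (α, 0) (pderiv (α, 1) u) + X (α, 1) * pderiv (α, 1) (pderiv (α, 1) u) =
      (C k - 1) * pderiv (α, 1) u := by
  have h := congrArg (pderiv (α, 1)) (euler hu)
  obtain ⟨-, -, h1, h2⟩ := pderiv_site α
  simp only [map_add, pderiv_mul, pderiv_C, h1, h2, pderiv_comm_apply (α, 1) (α, 0)] at h
  linear_combination h

theorem C_half_add_one (k : ℂ) : (C (k / 2 + 1) : Fock N) = C (1 / 2) * C k + 1 := by
  rw [← C_mul, ← C_1, ← C_add]
  congr 1
  ring

theorem two_mul_C_half : (2 : Fock N) * C (1 / 2) = 1 := by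
  have h : (2 : Fock N) = C 2 := (map_ofNat C 2).symm
  rw [h, ← C_mul, ← C_1]
  norm_num

section Contraction

variable {α : Fin N} {k : ℂ} {u v w : Fock N}

/-- With `u, v, w` the lowering, `z` and raising components of `D_c f`, the hypothesis `h` says that
`twist α c f` vanishes. Each of the three contractions takes a different second derivative of it at
`α` and removes the remaining second derivatives by Euler's identity. -/
theorem lower_contraction (hu : number α u = k • u) (hv : number α v = k • v)
    (h : X (α, 0) ^ 2 * u - 2 * X (α, 0) * X (α, 1) * v - X (α, 1) ^ 2 * w = 0) :
    lower α (Sz α v + (1 / 2 : ℂ) • (raise α u + lower α w)) =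
      (k / 2 + 1) • ((k / 2 + 1) • u + Sz α u - lower α v) := by
  obtain ⟨h1, h2, h3, h4⟩ := pderiv_site α
  -- Squares and the factor 2 are written out so that the product rule alone differentiates the
  -- relation.
  have h' : X (α, 0) * X (α, 0) * u - (X (α, 0) * X (α, 1) * v + X (α, 0) * X (α, 1) * v)
      - X (α, 1) * X (α, 1) * w = 0 := by linear_combination h
  have hE := congrArg (fun f => pderiv (α, 0) (pderiv (α, 0) f)) h'
  have hh := two_mul_C_half (N := N)
  have e1 := euler hu
  have e2 := euler_zero hu
  have e3 := euler_zero hv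
  simp only [map_add, map_sub, map_zero, pderiv_mul, h1, h2, pderiv_one] at hE
  simp only [Sz_eq, lower, raise, LinearMap.smul_apply, LinearMap.sub_apply, hopOp_apply,
    smul_eq_C_mul, C_half_add_one]
  simp only [map_add, map_sub, pderiv_mul, pderiv_C, h1, h2]
  generalize (C (1 / 2) : Fock N) = t at *
  generalize (C k : Fock N) = κ at *
  linear_combination (-t) * (hE + X (α, 1) * e3 - X (α, 0) * e2 - (t * κ + 2) * e1)
    + (u - X (α, 1) * pderiv (α, 0) v - X (α, 0) * t * κ * pderiv (α, 0) u) * hh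

theorem Sz_contraction (hu : number α u = k • u) (hv : number α v = k • v)
    (hw : number α w = k • w)
    (h : X (α, 0) ^ 2 * u - 2 * X (α, 0) * X (α, 1) * v - X (α, 1) ^ 2 * w = 0) :
    Sz α (Sz α v + (1 / 2 : ℂ) • (raise α u + lower α w)) =
      (k / 2 + 1) • ((k / 2 + 1) • v + (1 / 2 : ℂ) • (lower α w - raise α u)) := by
  obtain ⟨h1, h2, h3, h4⟩ := pderiv_site α
  have h' : X (α, 0) * X (α, 0) * u - (X (α, 0) * X (α, 1) * v + X (α, 0) * X (α, 1) * v)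
      - X (α, 1) * X (α, 1) * w = 0 := by linear_combination h
  have hE := congrArg (fun f => pderiv (α, 1) (pderiv (α, 0) f)) h'
  have hh := two_mul_C_half (N := N)
  have e1 := euler hv
  have e2 := euler_one hu
  have e3 := euler_zero hw
  have e4 := euler_zero hv
  have e5 := euler_one hv
  simp only [map_add, map_sub, map_zero, pderiv_mul, h1, h2, h3, h4, pderiv_one,
    pderiv_comm_apply (α, 1) (α, 0)] at hE
  simp only [Sz_eq, lower, raise, LinearMap.smul_apply, LinearMap.sub_apply, hopOp_apply,
    smul_eq_C_mul, C_half_add_one]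
  simp only [map_add, map_sub, pderiv_mul, pderiv_C, h1, h2, h3, h4,
    pderiv_comm_apply (α, 1) (α, 0)]
  generalize (C (1 / 2) : Fock N) = t at *
  generalize (C k : Fock N) = κ at *
  linear_combination t * hE - t ^ 2 * X (α, 0) * e2 + t ^ 2 * X (α, 1) * e3
    + t ^ 2 * (X (α, 0) * e4 + X (α, 1) * e5) + (1 + t ^ 2 * κ) * e1 + (X (α, 0) * pderiv (α, 0) v
      + X (α, 1) * pderiv (α, 1) v - κ * v + v
      - 2 * t * X (α, 0) * X (α, 1) * pderiv (α, 0) (pderiv (α, 1) v)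
      + t * X (α, 0) * pderiv (α, 1) u + t * X (α, 0) ^ 2 * pderiv (α, 0) (pderiv (α, 1) u)
      - t * X (α, 1) * pderiv (α, 0) w
      - t * X (α, 1) ^ 2 * pderiv (α, 0) (pderiv (α, 1) w)) * hh

theorem raise_contraction (hv : number α v = k • v) (hw : number α w = k • w)
    (h : X (α, 0) ^ 2 * u - 2 * X (α, 0) * X (α, 1) * v - X (α, 1) ^ 2 * w = 0) :
    raise α (Sz α v + (1 / 2 : ℂ) • (raise α u + lower α w)) =
      (k / 2 + 1) • ((k / 2 + 1) • w + raise α v - Sz α w) := by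
  obtain ⟨h1, h2, h3, h4⟩ := pderiv_site α
  have h' : X (α, 0) * X (α, 0) * u - (X (α, 0) * X (α, 1) * v + X (α, 0) * X (α, 1) * v)
      - X (α, 1) * X (α, 1) * w = 0 := by linear_combination h
  have hE := congrArg (fun f => pderiv (α, 1) (pderiv (α, 1) f)) h'
  have hh := two_mul_C_half (N := N)
  have e1 := euler hw
  have e2 := euler_one hw
  have e3 := euler_one hv
  simp only [map_add, map_sub, map_zero, pderiv_mul, h3, h4, pderiv_one] at hE
  simp only [Sz_eq, lower, raise, LinearMap.smul_apply, LinearMap.sub_apply, hopOp_apply,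
    smul_eq_C_mul, C_half_add_one]
  simp only [map_add, map_sub, pderiv_mul, pderiv_C, h3, h4,
    pderiv_comm_apply (α, 1) (α, 0)]
  generalize (C (1 / 2) : Fock N) = t at *
  generalize (C k : Fock N) = κ at *
  linear_combination t * (hE + X (α, 0) * e3 + X (α, 1) * e2 + (t * κ + 2) * e1)
    + (X (α, 0) * pderiv (α, 1) v - t * κ * X (α, 1) * pderiv (α, 1) w + w) * hh

end Contraction

/-! ### Weighted sums of spin operators -/

/-- The sum of the operators of a family with weights. -/
def weighted (F : Fin N → Op N) (c : Fin N → ℂ) : Op N := ∑ β, c β • F β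

theorem weighted_apply (F : Fin N → Op N) (c : Fin N → ℂ) (f : Fock N) :
    weighted F c f = ∑ β, c β • F β f := by
  simp [weighted, LinearMap.sum_apply]

theorem commute_weighted {A : Op N} {F : Fin N → Op N} {c : Fin N → ℂ}
    (h : ∀ β, c β ≠ 0 → Commute A (F β)) : Commute A (weighted F c) := by
  refine Commute.sum_right _ _ _ fun β _ => ?_
  by_cases hc : c β = 0
  · rw [hc, zero_smul]; exact Commute.zero_right _
  · exact (h β hc).smul_right _

/-- Local commutators only see equal sites, so the weights multiply pointwise. -/
theorem weighted_mul_weighted {F G K : Fin N → Op N} (c d : Fin N → ℂ)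
    (h : ∀ β γ, F β * G γ = G γ * F β + if β = γ then K β else 0) :
    weighted F c * weighted G d = weighted G d * weighted F c + weighted K (c * d) := by
  simp only [weighted, sum_mul_sum, smul_mul_smul_comm, h, smul_add, sum_add_distrib, smul_ite,
    smul_zero, sum_ite_eq, mem_univ, if_true, Pi.mul_apply]
  rw [sum_comm]
  simp only [mul_comm (c _)]

theorem weighted_smul (t : ℂ) (F : Fin N → Op N) (c : Fin N → ℂ) :
    weighted (fun β => t • F β) c = t • weighted F c := by
  simp only [weighted, smul_sum]
  exact sum_congr rfl fun β _ => smul_comm _ _ _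

theorem weighted_Sz_mul_weighted_raise (c d : Fin N → ℂ) :
    weighted Sz c * weighted raise d =
      weighted raise d * weighted Sz c + weighted raise (c * d) :=
  weighted_mul_weighted c d Sz_mul_raise

theorem weighted_Sz_mul_weighted_lower (c d : Fin N → ℂ) :
    weighted Sz c * weighted lower d =
      weighted lower d * weighted Sz c - weighted lower (c * d) := by
  rw [weighted_mul_weighted (K := fun β => (-1 : ℂ) • lower β) c d, weighted_smul]
  · module
  · intro β γ
    rw [Sz_mul_lower]
    split_ifs
    · module
    · rw [sub_zero, add_zero]

theorem weighted_raise_mul_weighted_lower (c d : Fin N → ℂ) :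
    weighted raise c * weighted lower d =
      weighted lower d * weighted raise c + (2 : ℂ) • weighted Sz (c * d) := by
  rw [weighted_mul_weighted c d raise_mul_lower, weighted_smul]

section Site

variable {α : Fin N} {c : Fin N → ℂ}

theorem ne_of_weight_ne_zero (hc : c α = 0) {β : Fin N} (hβ : c β ≠ 0) : α ≠ β := by
  rintro rfl
  exact hβ hc

theorem hopOp_commute_weighted_raise (hc : c α = 0) (i j : Fin 2) :
    Commute (hopOp α i j) (weighted raise c) :=
  commute_weighted fun _ hβ => hopOp_mul_hopOp_of_ne (ne_of_weight_ne_zero hc hβ) _ _ _ _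

theorem hopOp_commute_weighted_lower (hc : c α = 0) (i j : Fin 2) :
    Commute (hopOp α i j) (weighted lower c) :=
  commute_weighted fun _ hβ => hopOp_mul_hopOp_of_ne (ne_of_weight_ne_zero hc hβ) _ _ _ _

theorem hopOp_commute_weighted_Sz (hc : c α = 0) (i j : Fin 2) :
    Commute (hopOp α i j) (weighted Sz c) := by
  refine commute_weighted fun β hβ => ?_
  have h := ne_of_weight_ne_zero hc hβ
  have h0 : Commute (hopOp α i j) (hopOp β 0 0) := hopOp_mul_hopOp_of_ne h _ _ _ _
  have h1 : Commute (hopOp α i j) (hopOp β 1 1) := hopOp_mul_hopOp_of_ne h _ _ _ _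
  exact (h0.sub_right h1).smul_right _

theorem commute_Sz {A : Op N} (h : ∀ i j, Commute (hopOp α i j) A) : Commute (Sz α) A :=
  ((h 0 0).sub_left (h 1 1)).smul_left _

theorem weighted_SS (α : Fin N) (c : Fin N → ℂ) :
    weighted (SS α) c = Sz α * weighted Sz c +
      (1 / 2 : ℂ) • (raise α * weighted lower c + lower α * weighted raise c) := by
  simp only [weighted, mul_sum, smul_add, smul_sum, mul_smul_comm, SS_eq, sum_add_distrib]
  congr 2 <;> exact sum_congr rfl fun β _ => smul_comm _ _ _

theorem weighted_SS' (hc : c α = 0) :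
    weighted (SS α) c = weighted Sz c * Sz α +
      (1 / 2 : ℂ) • (weighted lower c * raise α + weighted raise c * lower α) := by
  rw [weighted_SS, (commute_Sz (hopOp_commute_weighted_Sz hc)).eq, raise, lower,
    (hopOp_commute_weighted_lower hc 0 1).eq, (hopOp_commute_weighted_raise hc 1 0).eq]

end Site

/-- `∑_{β, γ} c_β d_γ 𝐒_β · 𝐒_γ` -/
def dotSum (c d : Fin N → ℂ) : Op N := ∑ β, ∑ γ, (c β * d γ) • SS β γ

theorem dotSum_eq (c d : Fin N → ℂ) :
    dotSum c d = weighted Sz c * weighted Sz d + (1 / 2 : ℂ) •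
      (weighted raise c * weighted lower d + weighted lower c * weighted raise d) := by
  simp only [dotSum, weighted, sum_mul_sum, smul_add, smul_sum, smul_mul_smul_comm, SS_eq,
    sum_add_distrib]
  congr 2 <;> exact sum_congr rfl fun β _ => sum_congr rfl fun γ _ => smul_comm _ _ _

theorem dotSum_comm (c d : Fin N → ℂ) : dotSum c d = dotSum d c := by
  rw [dotSum, dotSum, sum_comm]
  refine sum_congr rfl fun β _ => sum_congr rfl fun γ _ => ?_
  rw [SS_comm, mul_comm]

/-! ### The twist operator and products of scalar products -/

/-- The operator `∑_β c_β (a†_α b†_β - b†_α a†_β) (a†_α a_β + b†_α b_β)`, for `c_α = 0`. -/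
def twist (α : Fin N) (c : Fin N → ℂ) : Op N :=
  LinearMap.mulLeft ℂ (X (α, 0) ^ 2) * weighted lower c
    - LinearMap.mulLeft ℂ (2 * X (α, 0) * X (α, 1)) * weighted Sz c
    - LinearMap.mulLeft ℂ (X (α, 1) ^ 2) * weighted raise c

theorem twist_apply (α : Fin N) (c : Fin N → ℂ) (f : Fock N) :
    twist α c f = X (α, 0) ^ 2 * weighted lower c f
      - 2 * X (α, 0) * X (α, 1) * weighted Sz c f - X (α, 1) ^ 2 * weighted raise c f := rfl

/-- Because `d α = 0`, the spin at `α` can be moved next to the inner factor, where the contractions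
apply. The last bracket is the triple product of `𝐒_α` with the two weighted spins. -/
theorem weighted_SS_mul_weighted_SS {α : Fin N} {k : ℕ} {f : Fock N} (hf : f ∈ spinSpace N k)
    {c d : Fin N → ℂ} (hd : d α = 0) (h : twist α c f = 0) :
    weighted (SS α) d (weighted (SS α) c f) = (k / 2 + 1 : ℂ) • ((k / 2 + 1 : ℂ) • dotSum d c f +
      (1 / 2 : ℂ) • (lower α ((weighted Sz d * weighted raise c - weighted raise d * weighted Sz c) f)
        + raise α ((weighted lower d * weighted Sz c - weighted Sz d * weighted lower c) f)
        + Sz α ((weighted raise d * weighted lower c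
            - weighted lower d * weighted raise c) f))) := by
  have hn : ∀ {A : Op N}, Commute (number α) A → number α (A f) = (k : ℂ) • A f := by
    intro A hA
    rw [← Module.End.mul_apply, hA.eq, Module.End.mul_apply, mem_spinSpace.1 hf α, map_smul]
  have hu := hn (commute_weighted (c := c) fun β _ => commute_number_lower α β)
  have hv := hn (commute_weighted (c := c) fun β _ => commute_number_Sz α β)
  have hw := hn (commute_weighted (c := c) fun β _ => commute_number_raise α β)
  rw [twist_apply] at h
  have e1 := lower_contraction hu hv h
  have e2 := Sz_contraction hu hv hw h
  have e3 := raise_contraction hv hw h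
  have comm : ∀ {A B : Op N} (g : Fock N), Commute A B → B (A g) = A (B g) :=
    fun g hAB => (LinearMap.congr_fun hAB.eq g).symm
  have c1 := hopOp_commute_weighted_lower hd
  have c2 := hopOp_commute_weighted_raise hd
  have c3 := hopOp_commute_weighted_Sz hd
  rw [weighted_SS' hd]
  simp only [LinearMap.add_apply, LinearMap.smul_apply, Module.End.mul_apply, dotSum_eq]
  rw [weighted_SS]
  simp only [LinearMap.add_apply, LinearMap.smul_apply, Module.End.mul_apply,
    LinearMap.sub_apply]
  rw [e1, e2, e3]
  simp only [map_add, map_sub, map_smul, comm _ (commute_Sz c1), comm _ (commute_Sz c2),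
    comm (A := raise α) _ (c1 0 1), comm (A := raise α) _ (c3 0 1),
    comm (A := lower α) _ (c2 1 0), comm (A := lower α) _ (c3 1 0)]
  module

/-- The triple product is antisymmetric in `c, d` up to commutators, so symmetrizing leaves only a
spin with the product weight. -/
theorem weighted_SS_anticomm {α : Fin N} {k : ℕ} {f : Fock N} (hf : f ∈ spinSpace N k)
    {c d : Fin N → ℂ} (hc : c α = 0) (hd : d α = 0) (h : twist α c f = 0)
    (h' : twist α d f = 0) :
    weighted (SS α) d (weighted (SS α) c f) + weighted (SS α) c (weighted (SS α) d f) =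
      (k / 2 + 1 : ℂ) • ((2 * (k / 2 + 1) : ℂ) • dotSum d c f
        + (2 : ℂ) • weighted (SS α) (d * c) f) := by
  rw [weighted_SS_mul_weighted_SS hf hd h, weighted_SS_mul_weighted_SS hf hc h',
    dotSum_comm c d, weighted_SS α (d * c), weighted_Sz_mul_weighted_raise d c,
    weighted_Sz_mul_weighted_raise c d, weighted_Sz_mul_weighted_lower d c,
    weighted_Sz_mul_weighted_lower c d, weighted_raise_mul_weighted_lower d c,
    weighted_raise_mul_weighted_lower c d, mul_comm c d]
  simp only [LinearMap.add_apply, LinearMap.smul_apply, Module.End.mul_apply,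
    LinearMap.sub_apply, map_add, map_sub, map_smul]
  module

/-! ### The Haldane–Shastry state -/

/-- The product state with bosons `a` at the sites in `A` and bosons `b` at the other sites. -/
def siteMon (A : Finset (Fin N)) : Fock N := ∏ i, X (i, if i ∈ A then 0 else 1)

/-- The product state without its factor at `β`. -/
def siteMonErase (β : Fin N) (A : Finset (Fin N)) : Fock N :=
  ∏ i ∈ univ.erase β, X (i, if i ∈ A then 0 else 1)

theorem siteMon_eq (β : Fin N) (A : Finset (Fin N)) :
    siteMon A = X (β, if β ∈ A then 0 else 1) * siteMonErase β A :=
  (mul_prod_erase univ _ (mem_univ β)).symm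

theorem siteMonErase_congr {β : Fin N} {A B : Finset (Fin N)}
    (h : ∀ i, i ≠ β → (i ∈ A ↔ i ∈ B)) : siteMonErase β A = siteMonErase β B := by
  refine prod_congr rfl fun i hi => ?_
  simp only [h i (ne_of_mem_erase hi)]

theorem pderiv_siteMonErase (β : Fin N) (j : Fin 2) (A : Finset (Fin N)) :
    pderiv (β, j) (siteMonErase β A) = 0 := by
  have h : ∀ s : Finset (Fin N), β ∉ s →
      pderiv (β, j) (∏ i ∈ s, X (i, if i ∈ A then 0 else 1) : Fock N) = 0 := by
    intro s
    induction s using Finset.induction_on with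
    | empty => simp
    | insert i s hi ih =>
      intro hβ
      have hne : (β, j) ≠ (i, if i ∈ A then 0 else 1) :=
        fun e => hβ (mem_insert.2 (Or.inl (congrArg Prod.fst e)))
      rw [prod_insert hi, pderiv_mul, ih fun h => hβ (mem_insert_of_mem h), mul_zero, add_zero,
        pderiv_X_eq_ite, if_neg hne, zero_mul]
  exact h _ (notMem_erase β univ)

theorem pderiv_siteMon (β : Fin N) (j : Fin 2) (A : Finset (Fin N)) :
    pderiv (β, j) (siteMon A) =
      if j = (if β ∈ A then 0 else 1) then siteMonErase β A else 0 := by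
  rw [siteMon_eq β, pderiv_mul, pderiv_siteMonErase, mul_zero, add_zero, pderiv_X_eq_ite]
  simp

theorem lower_siteMon (β : Fin N) (A : Finset (Fin N)) :
    lower β (siteMon A) = if β ∈ A then siteMon (A.erase β) else 0 := by
  rw [lower, hopOp_apply, pderiv_siteMon]
  by_cases h : β ∈ A
  · rw [siteMon_eq β (A.erase β), siteMonErase_congr (A := A.erase β) (B := A)]
    · simp [h]
    · intro i hi; simp [hi]
  · simp [h]

theorem raise_siteMon_compl (β : Fin N) (A : Finset (Fin N)) :
    raise β (siteMon Aᶜ) = if β ∈ A then siteMon (A.erase β)ᶜ else 0 := by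
  rw [raise, hopOp_apply, pderiv_siteMon]
  by_cases h : β ∈ A
  · rw [siteMon_eq β (A.erase β)ᶜ, siteMonErase_congr (A := (A.erase β)ᶜ) (B := Aᶜ)]
    · simp [h]
    · intro i hi; simp [hi]
  · simp [h]

theorem number_siteMon (β : Fin N) (A : Finset (Fin N)) :
    number β (siteMon A) = siteMon A := by
  rw [number, LinearMap.add_apply, hopOp_apply, hopOp_apply, pderiv_siteMon, pderiv_siteMon,
    siteMon_eq β]
  by_cases h : β ∈ A <;> simp [h]

/-- The Haldane--Shastry state, that is, the spin liquid state with spin `1 / 2`. -/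
def hsState (N : ℕ) : Fock N := ∑ A ∈ powersetCard (N / 2) univ, hsWave A • siteMon A

theorem sort_map_prod {M : Type*} [CommMonoid M] (A : Finset (Fin N)) (f : Fin N → M) :
    ((A.sort (· ≤ ·)).map f).prod = ∏ i ∈ A, f i := by
  rw [← List.prod_toFinset f (sort_nodup A _), sort_toFinset]

theorem prod_map_mulLeft {ι : Type*} (l : List ι) (f : ι → Fock N) :
    (l.map fun i => LinearMap.mulLeft ℂ (f i)).prod = LinearMap.mulLeft ℂ (l.map f).prod := by
  induction l with
  | nil => simp [Module.End.one_eq_id]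
  | cons i l ih =>
    rw [List.map_cons, List.prod_cons, ih, List.map_cons, List.prod_cons, LinearMap.mulLeft_mul]
    rfl

theorem hsOp_eq : hsOp N = LinearMap.mulLeft ℂ (hsState N) := by
  have h : ∀ A : Finset (Fin N),
      ((A.sort (· ≤ ·)).map aDag).prod * ((Aᶜ.sort (· ≤ ·)).map bDag).prod =
        LinearMap.mulLeft ℂ (siteMon A) := by
    intro A
    have h1 := prod_map_mulLeft (A.sort (· ≤ ·)) fun i => (X (i, 0) : Fock N)
    have h2 := prod_map_mulLeft (Aᶜ.sort (· ≤ ·)) fun i => (X (i, 1) : Fock N)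
    rw [sort_map_prod] at h1 h2
    have h3 : siteMon A = (∏ i ∈ A, X (i, 0)) * ∏ i ∈ Aᶜ, X (i, 1) := by
      rw [siteMon, ← prod_mul_prod_compl A]
      congr 1
      · exact prod_congr rfl fun i hi => by rw [if_pos hi]
      · exact prod_congr rfl fun i hi => by rw [if_neg (mem_compl.1 hi)]
    rw [h3, LinearMap.mulLeft_mul]
    exact congrArg₂ (· * ·) h1 h2
  refine LinearMap.ext fun f => ?_
  simp only [hsOp, h, LinearMap.sum_apply, LinearMap.smul_apply, LinearMap.mulLeft_apply,
    hsState, sum_mul, smul_mul_assoc]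

theorem spinLiquid_eq (k : ℕ) : spinLiquid N k = hsState N ^ k := by
  rw [spinLiquid, hsOp_eq, LinearMap.pow_mulLeft, vac, LinearMap.mulLeft_apply, mul_one]

theorem hsState_ne_zero : hsState N ≠ 0 := by
  obtain ⟨A₀, hA₀⟩ : (powersetCard (N / 2) (univ : Finset (Fin N))).Nonempty := by
    rw [powersetCard_nonempty, card_univ, Fintype.card_fin]
    omega
  intro h
  -- This 0/1 point isolates the single monomial of `A₀`.
  have h1 := congrArg (eval fun p : Fin N × Fin 2 =>
    if p.2 = (if p.1 ∈ A₀ then 0 else 1) then (1 : ℂ) else 0) h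
  rw [hsState, map_sum, map_zero, sum_eq_single A₀] at h1
  · rw [smul_eval, siteMon, eval_prod] at h1
    simp at h1
    exact hsWave_ne_zero _ h1
  · intro A _ hA
    rw [smul_eval, siteMon, eval_prod]
    obtain ⟨i, hi⟩ : ∃ i, ¬(i ∈ A ↔ i ∈ A₀) := by
      by_contra! hcon
      exact hA (ext hcon)
    rw [prod_eq_zero (mem_univ i), mul_zero]
    rw [eval_X, if_neg]
    by_cases h1 : i ∈ A <;> by_cases h2 : i ∈ A₀ <;> simp_all
  · exact fun hn => absurd hA₀ hn

/-- Reindexing by `A = insert β B`. The family `φ` is abstract so that lowering on `siteMon A` and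
raising on `siteMon Aᶜ` are both covered. -/
theorem weighted_sum_hsWave {F : Fin N → Op N} {φ : Finset (Fin N) → Fock N}
    (h : ∀ β A, F β (φ A) = if β ∈ A then φ (A.erase β) else 0) (c : Fin N → ℂ) (m : ℕ) :
    weighted F c (∑ A ∈ powersetCard (m + 1) univ, hsWave A • φ A) =
      ∑ B ∈ powersetCard m univ,
        (∑ β, if β ∈ B then 0 else c β * hsWave (insert β B)) • φ B := by
  have h1 : ∀ β, c β • F β (∑ A ∈ powersetCard (m + 1) univ, hsWave A • φ A) =
      ∑ B ∈ powersetCard m univ, (if β ∈ B then 0 else c β * hsWave (insert β B)) • φ B := by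
    intro β
    simp only [map_sum, map_smul, h, smul_sum, smul_ite, smul_zero, ite_smul, zero_smul]
    rw [sum_ite, sum_const_zero, add_zero, sum_ite, sum_const_zero, zero_add]
    refine sum_nbij' (fun A => A.erase β) (fun B => insert β B) ?_ ?_ ?_ ?_ ?_
    · intro A hA
      rw [mem_filter, mem_powersetCard] at hA
      rw [mem_filter, mem_powersetCard, card_erase_of_mem hA.2, hA.1.2]
      exact ⟨⟨subset_univ _, rfl⟩, notMem_erase _ _⟩
    · intro B hB
      rw [mem_filter, mem_powersetCard] at hB
      rw [mem_filter, mem_powersetCard, card_insert_of_notMem hB.2, hB.1.2]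
      exact ⟨⟨subset_univ _, rfl⟩, mem_insert_self _ _⟩
    · exact fun A hA => insert_erase (mem_filter.1 hA).2
    · exact fun B hB => erase_insert (mem_filter.1 hB).2
    · intro A hA
      rw [insert_erase (mem_filter.1 hA).2, smul_smul]
  rw [weighted_apply, sum_congr rfl fun β _ => h1 β, sum_comm]
  exact sum_congr rfl fun B _ => (sum_smul).symm

theorem number_hsState (α : Fin N) : number α (hsState N) = hsState N := by
  rw [hsState, map_sum]
  exact sum_congr rfl fun A _ => by rw [map_smul, number_siteMon]

theorem weighted_lower_one_hsState {m : ℕ} (hN : N = 2 * (m + 1)) : weighted lower 1 (hsState N) = 0 := by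
  have hm : N / 2 = m + 1 := by omega
  rw [hsState, hm, weighted_sum_hsWave lower_siteMon]
  refine sum_eq_zero fun B hB => ?_
  simp only [Pi.one_apply, one_mul]
  rw [sum_hsWave_insert, zero_smul]
  rw [(mem_powersetCard.1 hB).2]
  omega

theorem hsState_eq_compl {m : ℕ} (hN : N = 2 * (m + 1)) :
    hsState N = (-1 : ℂ) ^ (m + 1) • ∑ A ∈ powersetCard (m + 1) univ, hsWave A • siteMon Aᶜ := by
  have hm : N / 2 = m + 1 := by omega
  have hc : ∀ A ∈ powersetCard (m + 1) (univ : Finset (Fin N)),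
      Aᶜ ∈ powersetCard (m + 1) (univ : Finset (Fin N)) := by
    intro A hA
    rw [mem_powersetCard, card_compl, (mem_powersetCard.1 hA).2, Fintype.card_fin]
    exact ⟨subset_univ _, by omega⟩
  rw [hsState, hm, smul_sum]
  refine sum_nbij' (fun A => Aᶜ) (fun A => Aᶜ) hc hc (fun A _ => compl_compl A)
    (fun A _ => compl_compl A) fun A hA => ?_
  have h1 := (mem_powersetCard.1 hA).2
  have h2 := (mem_powersetCard.1 (hc A hA)).2
  rw [hsWave_compl (h2.trans h1.symm), compl_compl, smul_smul, ← mul_assoc, h1, ← mul_pow]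
  simp

theorem weighted_raise_one_hsState {m : ℕ} (hN : N = 2 * (m + 1)) : weighted raise 1 (hsState N) = 0 := by
  rw [hsState_eq_compl hN, map_smul,
    weighted_sum_hsWave (φ := fun A => siteMon Aᶜ) raise_siteMon_compl]
  refine smul_eq_zero_of_right _ (sum_eq_zero fun B hB => ?_)
  simp only [Pi.one_apply, one_mul]
  rw [sum_hsWave_insert, zero_smul]
  rw [(mem_powersetCard.1 hB).2]
  omega

/-- The derivative keeps exactly the sets `B` containing `α`, for which the weighted sum vanishes.
-/
theorem pderiv_weighted_lower_gap_hsState {m : ℕ} (hN : N = 2 * (m + 1)) (α : Fin N) :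
    pderiv (α, 0) (weighted lower (gap α) (hsState N)) = 0 := by
  have hm : N / 2 = m + 1 := by omega
  rw [hsState, hm, weighted_sum_hsWave lower_siteMon, map_sum]
  refine sum_eq_zero fun B hB => ?_
  rw [Derivation.map_smul, pderiv_siteMon]
  by_cases h : α ∈ B
  · rw [sum_gap_mul_hsWave_insert h, zero_smul]
    rw [(mem_powersetCard.1 hB).2]
    omega
  · simp [h]

/-! ### The twist operator on a singlet with spin `1 / 2` at a site -/

theorem commute_create_hopOp {α β : Fin N} (h : α ≠ β) (i k l : Fin 2) :
    Commute (create (α, i)) (hopOp β k l) := by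
  refine LinearMap.ext fun f => ?_
  have h1 : (β, l) ≠ (α, i) := fun e => h (congrArg Prod.fst e).symm
  simp only [Module.End.mul_apply, create, LinearMap.mulLeft_apply, hopOp_apply, pderiv_mul,
    pderiv_X_eq_ite, if_neg h1]
  ring

theorem annihilate_mul_hopOp (i : Fin N × Fin 2) (β : Fin N) (k l : Fin 2) :
    annihilate i * hopOp β k l =
      hopOp β k l * annihilate i + if i = (β, k) then annihilate (β, l) else 0 := by
  refine LinearMap.ext fun f => ?_
  simp only [Module.End.mul_apply, LinearMap.add_apply, annihilate, Derivation.coeFn_coe,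
    hopOp_apply, pderiv_mul, pderiv_X_eq_ite, pderiv_comm_apply (β, l) i]
  split_ifs
  · simp; ring
  · simp

theorem commute_annihilate_hopOp {α β : Fin N} (h : α ≠ β) (i k l : Fin 2) :
    Commute (annihilate (α, i)) (hopOp β k l) := by
  have h1 : (α, i) ≠ (β, k) := fun e => h (congrArg Prod.fst e)
  exact (annihilate_mul_hopOp _ _ _ _).trans (by rw [if_neg h1, add_zero])

theorem commute_weighted_of_forall {A : Op N} {α : Fin N} {c : Fin N → ℂ} (hc : c α = 0)
    (h : ∀ β, α ≠ β → ∀ i j, Commute A (hopOp β i j)) :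
    Commute A (weighted lower c) ∧ Commute A (weighted Sz c) ∧ Commute A (weighted raise c) :=
  ⟨commute_weighted fun _ hβ => h _ (ne_of_weight_ne_zero hc hβ) _ _,
    commute_weighted fun _ hβ => ((h _ (ne_of_weight_ne_zero hc hβ) _ _).sub_right
      (h _ (ne_of_weight_ne_zero hc hβ) _ _)).smul_right _,
    commute_weighted fun _ hβ => h _ (ne_of_weight_ne_zero hc hβ) _ _⟩

theorem pderiv_zero_weighted_raise_one (α : Fin N) (f : Fock N) :
    pderiv (α, 0) (weighted raise 1 f) =
      weighted raise 1 (pderiv (α, 0) f) + pderiv (α, 1) f := by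
  have h : annihilate (α, 0) * weighted raise (1 : Fin N → ℂ) =
      weighted raise 1 * annihilate (α, 0) + annihilate (α, 1) := by
    simp only [weighted, mul_sum, sum_mul, Pi.one_apply, one_smul, raise, annihilate_mul_hopOp,
      sum_add_distrib, Prod.mk.injEq, and_true, sum_ite_eq, mem_univ, if_true]
  exact LinearMap.congr_fun h f

theorem pderiv_one_weighted_raise_one (α : Fin N) (f : Fock N) :
    pderiv (α, 1) (weighted raise 1 f) = weighted raise 1 (pderiv (α, 1) f) := by
  have h : annihilate (α, 1) * weighted raise (1 : Fin N → ℂ) =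
      weighted raise 1 * annihilate (α, 1) := by
    simp only [weighted, mul_sum, sum_mul, Pi.one_apply, one_smul, raise, annihilate_mul_hopOp,
      Prod.mk.injEq, one_ne_zero, and_false, if_false, add_zero]
  exact LinearMap.congr_fun h f

/-- A state `f` with spin `1 / 2` at `α` which is annihilated by the total raising operator is
annihilated by `twist α c`, if its component with spin up at `α` is annihilated by the weighted
lowering operator. -/
theorem twist_eq_zero {α : Fin N} {c : Fin N → ℂ} (hc : c α = 0) {f : Fock N}
    (hn : number α f = f) (hR : weighted raise 1 f = 0)
    (h0 : pderiv (α, 0) (weighted lower c f) = 0) : twist α c f = 0 := by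
  set p := pderiv (α, 0) f with hp
  set q := pderiv (α, 1) f with hq
  have hf : f = X (α, 0) * p + X (α, 1) * q := hn.symm
  have R0 : weighted raise 1 p = -q := by
    have h := pderiv_zero_weighted_raise_one α f
    rw [hR, map_zero] at h
    exact eq_neg_of_add_eq_zero_left h.symm
  have R1 : weighted raise 1 q = 0 := by
    rw [hq, ← pderiv_one_weighted_raise_one, hR, map_zero]
  have L0 : weighted lower c p = 0 := by
    have h := (commute_weighted_of_forall hc (A := annihilate (α, 0))
      fun β hβ => commute_annihilate_hopOp hβ 0).1
    exact (LinearMap.congr_fun h.eq f).symm.trans h0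
  have cL : ∀ g, weighted raise 1 (weighted lower c g) =
      weighted lower c (weighted raise 1 g) + (2 : ℂ) • weighted Sz c g := by
    intro g
    have h := LinearMap.congr_fun (weighted_raise_mul_weighted_lower 1 c) g
    rwa [one_mul] at h
  have cZ : ∀ g, weighted Sz c (weighted raise 1 g) =
      weighted raise 1 (weighted Sz c g) + weighted raise c g := by
    intro g
    have h := LinearMap.congr_fun (weighted_Sz_mul_weighted_raise c 1) g
    rwa [mul_one] at h
  have cR : ∀ g, weighted raise 1 (weighted raise c g) =
      weighted raise c (weighted raise 1 g) := by
    intro g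
    have h : Commute (weighted raise 1) (weighted raise c) := commute_weighted fun β _ =>
      (commute_weighted fun γ _ => raise_mul_raise β γ).symm
    exact LinearMap.congr_fun h.eq g
  have L1 : weighted lower c q = (2 : ℂ) • weighted Sz c p := by
    have h := cL p
    rw [L0, R0, map_zero, map_neg] at h
    linear_combination (exp := 1) h
  have P0 : weighted raise c p = (-2 : ℂ) • weighted Sz c q := by
    have h1 := cL q
    have h2 := cZ p
    rw [R1, map_zero, L1, map_smul] at h1
    rw [R0, map_neg] at h2
    linear_combination (norm := module) (-1 : ℂ) • h2 - (1 / 2 : ℂ) • h1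
  -- The two relations combine to `3 • weighted raise c q = 0`.
  have P1 : weighted raise c q = 0 := by
    have h1 := cR p
    have h2 := cZ q
    rw [R0, P0, map_neg, map_smul] at h1
    rw [R1, map_zero] at h2
    linear_combination (norm := module) (1 / 3 : ℂ) • h1 - (2 / 3 : ℂ) • h2
  have hX : ∀ i g, weighted lower c (X (α, i) * g) = X (α, i) * weighted lower c g ∧
      weighted Sz c (X (α, i) * g) = X (α, i) * weighted Sz c g ∧
      weighted raise c (X (α, i) * g) = X (α, i) * weighted raise c g := by
    intro i g
    obtain ⟨e1, e2, e3⟩ := commute_weighted_of_forall hc (A := create (α, i))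
      fun β hβ => commute_create_hopOp hβ i
    exact ⟨(LinearMap.congr_fun e1.eq g).symm, (LinearMap.congr_fun e2.eq g).symm,
      (LinearMap.congr_fun e3.eq g).symm⟩
  -- The result is a binary cubic in the variables at `α`; its coefficients vanish by `L0`, `L1`,
  -- `P0`, `P1`. They are the four components of a spin `3/2` multiplet.
  rw [twist_apply, hf]
  simp only [map_add, hX, L0, L1, P0, P1, smul_eq_C_mul, map_neg, map_ofNat]
  ring

/-! ### From spin `1 / 2` to powers of the state -/

/-- The Leibniz rule for an operator. -/
def IsLeibniz (A : Op N) : Prop := ∀ f g, A (f * g) = f * A g + g * A f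

namespace IsLeibniz

variable {A B : Op N}

theorem add (hA : IsLeibniz A) (hB : IsLeibniz B) : IsLeibniz (A + B) := fun f g => by
  simp only [LinearMap.add_apply, hA f g, hB f g]; ring

theorem sub (hA : IsLeibniz A) (hB : IsLeibniz B) : IsLeibniz (A - B) := fun f g => by
  simp only [LinearMap.sub_apply, hA f g, hB f g]; ring

theorem smul (t : ℂ) (hA : IsLeibniz A) : IsLeibniz (t • A) := fun f g => by
  simp only [LinearMap.smul_apply, hA f g, smul_eq_C_mul]; ring

theorem mulLeft_mul (p : Fock N) (hA : IsLeibniz A) :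
    IsLeibniz (LinearMap.mulLeft ℂ p * A) := fun f g => by
  simp only [Module.End.mul_apply, LinearMap.mulLeft_apply, hA f g]; ring

theorem weighted {F : Fin N → Op N} (hF : ∀ β, IsLeibniz (F β)) (c : Fin N → ℂ) :
    IsLeibniz (weighted F c) := fun f g => by
  simp only [weighted_apply, hF _ f g, mul_sum, ← sum_add_distrib, smul_add, mul_smul_comm]

theorem Sz (α : Fin N) : IsLeibniz (Sz α) :=
  smul _ (sub (hopOp_mul α 0 0) (hopOp_mul α 1 1))

theorem number (α : Fin N) : IsLeibniz (number α) :=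
  add (hopOp_mul α 0 0) (hopOp_mul α 1 1)

theorem twist (α : Fin N) (c : Fin N → ℂ) : IsLeibniz (twist α c) :=
  sub (sub (mulLeft_mul _ (weighted (fun β => hopOp_mul β 1 0) c))
    (mulLeft_mul _ (weighted Sz c))) (mulLeft_mul _ (weighted (fun β => hopOp_mul β 0 1) c))

theorem pow_apply (hA : IsLeibniz A) {t : ℂ} {f : Fock N} (h : A f = t • f) (k : ℕ) :
    A (f ^ k) = (k * t) • f ^ k := by
  induction k with
  | zero =>
    have h1 := hA 1 1
    simp only [one_mul] at h1
    simpa using h1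
  | succ k ih =>
    rw [pow_succ, hA, ih, h]
    simp only [smul_eq_C_mul, Nat.cast_succ, C_mul, C_add, C_1, add_mul]
    ring

theorem pow_apply_eq_zero (hA : IsLeibniz A) {f : Fock N} (h : A f = 0) (k : ℕ) :
    A (f ^ k) = 0 := by
  rw [hA.pow_apply (t := 0) (by rw [h, zero_smul]), mul_zero, zero_smul]

end IsLeibniz

theorem hsState_pow_mem_spinSpace (k : ℕ) : hsState N ^ k ∈ spinSpace N k := by
  rw [mem_spinSpace]
  intro α
  rw [(IsLeibniz.number α).pow_apply (t := 1) (by rw [one_smul, number_hsState]), mul_one]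

section State

variable {m : ℕ} (k : ℕ)

theorem weighted_lower_one_hsState_pow (hN : N = 2 * (m + 1)) :
    weighted lower 1 (hsState N ^ k) = 0 :=
  (IsLeibniz.weighted (fun β => hopOp_mul β 1 0) 1).pow_apply_eq_zero
    (weighted_lower_one_hsState hN) k

theorem weighted_raise_one_hsState_pow (hN : N = 2 * (m + 1)) :
    weighted raise 1 (hsState N ^ k) = 0 :=
  (IsLeibniz.weighted (fun β => hopOp_mul β 0 1) 1).pow_apply_eq_zero
    (weighted_raise_one_hsState hN) k

theorem weighted_Sz_one_hsState_pow (hN : N = 2 * (m + 1)) :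
    weighted Sz 1 (hsState N ^ k) = 0 := by
  have h := LinearMap.congr_fun (weighted_raise_mul_weighted_lower (N := N) 1 1) (hsState N ^ k)
  simp only [LinearMap.add_apply, LinearMap.smul_apply, Module.End.mul_apply,
    weighted_lower_one_hsState_pow k hN, weighted_raise_one_hsState_pow k hN, map_zero, zero_add,
    one_mul] at h
  exact (smul_eq_zero.1 h.symm).resolve_left two_ne_zero

theorem twist_gap_hsState_pow (hN : N = 2 * (m + 1)) (α : Fin N) :
    twist α (gap α) (hsState N ^ k) = 0 :=
  (IsLeibniz.twist α _).pow_apply_eq_zero (twist_eq_zero (gap_self α) (number_hsState α)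
    (weighted_raise_one_hsState hN) (pderiv_weighted_lower_gap_hsState hN α)) k

/-- Substituting `η β = η α - (η α - η β)` in `conj_gap`; the last term restores the value `0` at `β
= α`. -/
theorem conj_gap_eq (α : Fin N) : (fun β => conj (gap α β)) =
    η α • (1 : Fin N → ℂ) - (η α ^ 2) • gap α - η α • Pi.single α 1 := by
  funext β
  by_cases h : β = α
  · subst h; simp
  · simp only [Pi.sub_apply, Pi.smul_apply, Pi.one_apply, Pi.single_apply, if_neg h, smul_eq_mul,
      conj_gap]
    linear_combination η α * gap_mul (Ne.symm h)

theorem weighted_lin (F : Fin N → Op N) (s t r : ℂ) (c d e : Fin N → ℂ) (f : Fock N) :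
    weighted F (s • c - t • d - r • e) f =
      s • weighted F c f - t • weighted F d f - r • weighted F e f := by
  simp only [weighted_apply, Pi.sub_apply, Pi.smul_apply, sub_smul, sum_sub_distrib, smul_sum,
    smul_eq_mul, mul_smul]

theorem twist_lin (α : Fin N) (s t r : ℂ) (c d e : Fin N → ℂ) (f : Fock N) :
    twist α (s • c - t • d - r • e) f =
      s • twist α c f - t • twist α d f - r • twist α e f := by
  simp only [twist_apply, weighted_lin, smul_eq_C_mul]
  ring

theorem weighted_single (F : Fin N → Op N) (α : Fin N) :
    weighted F (Pi.single α 1) = F α := by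
  simp [weighted, Pi.single_apply]

theorem twist_single (α : Fin N) (f : Fock N) : twist α (Pi.single α 1) f = 0 := by
  simp only [twist_apply, weighted_single, lower, raise, Sz_eq, LinearMap.smul_apply,
    LinearMap.sub_apply, hopOp_apply, smul_eq_C_mul]
  linear_combination (-(X (α, 0) * X (α, 1) * (X (α, 0) * pderiv (α, 0) f
    - X (α, 1) * pderiv (α, 1) f))) * two_mul_C_half (N := N)

theorem twist_conj_gap_hsState_pow (hN : N = 2 * (m + 1)) (α : Fin N) :
    twist α (fun β => conj (gap α β)) (hsState N ^ k) = 0 := by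
  rw [conj_gap_eq, twist_lin, twist_gap_hsState_pow k hN, twist_single, twist_apply,
    weighted_lower_one_hsState_pow k hN, weighted_raise_one_hsState_pow k hN,
    weighted_Sz_one_hsState_pow k hN]
  simp

theorem dotSum_one_hsState_pow (hN : N = 2 * (m + 1)) :
    dotSum 1 1 (hsState N ^ k) = 0 := by
  rw [dotSum_eq]
  simp only [LinearMap.add_apply, LinearMap.smul_apply, Module.End.mul_apply,
    weighted_lower_one_hsState_pow k hN, weighted_raise_one_hsState_pow k hN,
    weighted_Sz_one_hsState_pow k hN, map_zero, smul_zero, add_zero]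

end State

/-! ### The Hamiltonian and its eigenvalue -/

theorem sum_filter_ne_smul {M : Type*} [AddCommMonoid M] [Module ℂ M] (α : Fin N)
    (c : Fin N → ℂ) (hc : c α = 0) (x : Fin N → M) :
    ∑ β : Fin N with α ≠ β, c β • x β = ∑ β, c β • x β := by
  refine sum_filter_of_ne fun β _ h => ?_
  rintro rfl
  exact h (by rw [hc, zero_smul])

theorem one_div_norm_sq (α β : Fin N) :
    ((1 / ‖η α - η β‖ ^ 2 : ℝ) : ℂ) = conj (gap α β) * gap α β := by
  rw [Complex.conj_mul', gap, norm_div, norm_one]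
  push_cast
  rw [div_pow, one_pow]

theorem one_div_conj_sub_mul_sub (α β γ : Fin N) :
    1 / ((conj (η α) - conj (η β)) * (η α - η γ)) = conj (gap α β) * gap α γ := by
  rw [gap, gap, map_div₀, map_one, map_sub, one_div_mul_one_div]

/-- The two-site part of the Hamiltonian. -/
def pairSum (N : ℕ) : Op N := ∑ α, weighted (SS α) ((fun β => conj (gap α β)) * gap α)

theorem hamiltonian_eq (S : ℝ) : hamiltonian N S = ((2 * Real.pi ^ 2 / N ^ 2 : ℝ) : ℂ) •
    (pairSum N - ((1 / (2 * (S + 1) * (2 * S + 3)) : ℝ) : ℂ) • ∑ α,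
      (weighted (SS α) (fun β => conj (gap α β)) * weighted (SS α) (gap α)
        + weighted (SS α) (gap α) * weighted (SS α) fun β => conj (gap α β))) := by
  have h1 : ∑ α : Fin N, ∑ β : Fin N with α ≠ β,
      ((1 / ‖η α - η β‖ ^ 2 : ℝ) : ℂ) • SS α β = pairSum N := by
    refine sum_congr rfl fun α _ => ?_
    simp only [one_div_norm_sq]
    rw [sum_filter_ne_smul α _ (by simp)]
    rfl
  rw [hamiltonian, h1]
  congr 3
  refine sum_congr rfl fun α _ => ?_
  simp only [one_div_conj_sub_mul_sub, mul_smul, ← smul_sum]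
  rw [sum_filter_ne_smul α _ (by simp)]
  simp only [weighted, sum_mul_sum]
  rw [sum_comm (f := fun i j => (gap α i • SS α i) * _), ← sum_add_distrib]
  refine sum_congr rfl fun β _ => ?_
  rw [sum_filter_ne_smul α _ (by simp), smul_sum, ← sum_add_distrib]
  refine sum_congr rfl fun γ _ => ?_
  rw [smul_mul_smul_comm, smul_mul_smul_comm, smul_smul, smul_add, mul_comm (gap α γ)]

/-- Exchanging `β` and `γ` in the second product conjugates its coefficient, so the two add up to
twice the real part. -/
theorem hamiltonian_eq_re (S : ℝ) : hamiltonian N S =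
    ((2 * Real.pi ^ 2 / N ^ 2 : ℝ) : ℂ) •
      ((∑ α : Fin N, ∑ β : Fin N with α ≠ β,
          ((1 / ‖η α - η β‖ ^ 2 : ℝ) : ℂ) • SS α β)
        - ∑ α : Fin N, ∑ β : Fin N with α ≠ β, ∑ γ : Fin N with α ≠ γ,
            (((1 / ((conj (η α) - conj (η β)) * (η α - η γ))).re
              / ((S + 1) * (2 * S + 3)) : ℝ) : ℂ) • (SS α β * SS α γ)) := by
  rw [hamiltonian]
  congr 2
  rw [smul_sum]
  refine sum_congr rfl fun α _ => ?_
  simp only [smul_add, sum_add_distrib]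
  rw [← smul_add, sum_comm (f := fun β γ => (1 / ((conj (η α) - conj (η β)) * (η α - η γ))) •
    (SS α γ * SS α β)), ← sum_add_distrib, smul_sum]
  refine sum_congr rfl fun β _ => ?_
  rw [← sum_add_distrib, smul_sum]
  refine sum_congr rfl fun γ _ => ?_
  rw [← add_smul, smul_smul]
  congr 1
  have h : 1 / ((conj (η α) - conj (η γ)) * (η α - η β)) =
      conj (1 / ((conj (η α) - conj (η β)) * (η α - η γ))) := by
    simp only [map_div₀, map_one, map_mul, map_sub, Complex.conj_conj]
    rw [mul_comm]
  rw [h, Complex.add_conj, ← Complex.ofReal_mul]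
  congr 1
  rw [div_mul_eq_mul_div, one_mul, mul_assoc 2, mul_div_mul_left _ _ (two_ne_zero)]

theorem commute_number_weighted_SS (α β : Fin N) (c : Fin N → ℂ) :
    Commute (number α) (weighted (SS β) c) :=
  commute_weighted fun γ _ => commute_number_SS α β γ

theorem commute_number_hamiltonian (α : Fin N) (S : ℝ) :
    Commute (number α) (hamiltonian N S) := by
  rw [hamiltonian_eq, pairSum]
  have h1 : Commute (number α) (∑ β : Fin N,
      weighted (SS β) ((fun γ => conj (gap β γ)) * gap β)) :=
    Commute.sum_right _ _ _ fun β _ => commute_number_weighted_SS _ _ _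
  have h2 : Commute (number α) (∑ β : Fin N,
      (weighted (SS β) (fun γ => conj (gap β γ)) * weighted (SS β) (gap β)
        + weighted (SS β) (gap β) * weighted (SS β) fun γ => conj (gap β γ))) := by
    refine Commute.sum_right _ _ _ fun β _ => ?_
    have e1 := commute_number_weighted_SS α β fun γ => conj (gap β γ)
    have e2 := commute_number_weighted_SS α β (gap β)
    exact (e1.mul_right e2).add_right (e2.mul_right e1)
  exact (h1.sub_right (h2.smul_right _)).smul_right _

theorem hamiltonian_mem_spinSpace {k : ℕ} {f : Fock N} (hf : f ∈ spinSpace N k) (S : ℝ) :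
    hamiltonian N S f ∈ spinSpace N k := by
  rw [mem_spinSpace] at hf ⊢
  intro α
  rw [← Module.End.mul_apply, (commute_number_hamiltonian α S).eq, Module.End.mul_apply, hf α,
    map_smul]

theorem sum_dotSum : ∑ α : Fin N, dotSum (fun β => conj (gap α β)) (gap α) =
    ∑ β, ∑ γ, triple β γ • SS β γ := by
  simp only [dotSum, triple, sum_smul]
  rw [sum_comm]
  refine sum_congr rfl fun β _ => ?_
  rw [sum_comm]

/-- By symmetry of `SS`, only the symmetric part of `triple` contributes, and that is given by
`triple_add_triple`. -/
theorem sum_dotSum_eq : ∑ α : Fin N, dotSum (fun β => conj (gap α β)) (gap α) =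
    (2 : ℂ) • pairSum N - (1 / 2 : ℂ) • dotSum 1 1
      + ∑ β : Fin N, (triple β β + 1 / 2) • SS β β := by
  have h1 : ∑ β : Fin N, ∑ γ : Fin N, triple β γ • SS β γ =
      ∑ β : Fin N, ∑ γ : Fin N, ((1 / 2 : ℂ) * (triple β γ + triple γ β)) • SS β γ := by
    have h2 : ∑ β : Fin N, ∑ γ : Fin N, triple γ β • SS β γ =
        ∑ β : Fin N, ∑ γ : Fin N, triple β γ • SS β γ := by
      rw [sum_comm]
      exact sum_congr rfl fun β _ => sum_congr rfl fun γ _ => by rw [SS_comm]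
    simp only [mul_add, add_smul, sum_add_distrib, mul_smul, ← smul_sum]
    rw [h2]
    module
  have h3 : ∀ β γ : Fin N, ((1 / 2 : ℂ) * (triple β γ + triple γ β)) • SS β γ =
      (2 : ℂ) • ((conj (gap β γ) * gap β γ) • SS β γ)
        - (1 / 2 : ℂ) • (((1 : Fin N → ℂ) β * (1 : Fin N → ℂ) γ) • SS β γ)
        + if β = γ then (triple β β + 1 / 2) • SS β γ else 0 := by
    intro β γ
    rw [triple_add_triple]
    split_ifs
    · simp only [Pi.one_apply]; module
    · simp only [Pi.one_apply]; module
  rw [sum_dotSum, h1]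
  simp only [h3, sum_add_distrib, sum_sub_distrib, ← smul_sum, sum_ite_eq, mem_univ, if_true]
  rfl

theorem hamiltonian_hsState_pow {m : ℕ} (hN : N = 2 * (m + 1)) (k : ℕ) {S : ℝ}
    (hS : S = (k : ℝ) / 2) :
    hamiltonian N S (hsState N ^ k) = (energy N S : ℂ) • hsState N ^ k := by
  set f := hsState N ^ k with hf
  have hmem : f ∈ spinSpace N k := hsState_pow_mem_spinSpace k
  have hk : (k / 2 : ℂ) = S := by rw [hS]; push_cast; rfl
  have hSpos : 0 ≤ S := by rw [hS]; positivity
  have h1 : (S + 1 : ℂ) ≠ 0 := by exact_mod_cast (by positivity : S + 1 ≠ 0)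
  have h2 : (2 * S + 3 : ℂ) ≠ 0 := by exact_mod_cast (by positivity : 2 * S + 3 ≠ 0)
  have hanti : ∀ α : Fin N,
      (weighted (SS α) (fun β => conj (gap α β)) * weighted (SS α) (gap α)
        + weighted (SS α) (gap α) * weighted (SS α) fun β => conj (gap α β)) f =
      (S + 1 : ℂ) • ((2 * (S + 1) : ℂ) • dotSum (fun β => conj (gap α β)) (gap α) f
        + (2 : ℂ) • weighted (SS α) ((fun β => conj (gap α β)) * gap α) f) := by
    intro α
    have h := weighted_SS_anticomm hmem (c := gap α) (d := fun β => conj (gap α β))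
      (gap_self α) (by simp) (twist_gap_hsState_pow k hN α) (twist_conj_gap_hsState_pow k hN α)
    rwa [hk] at h
  have hdot := LinearMap.congr_fun (sum_dotSum_eq (N := N)) f
  have hself : (∑ β : Fin N, (triple β β + 1 / 2) • SS β β) f =
      ((N : ℂ) * (N ^ 2 + 5) / 12 * (S * (S + 1))) • f := by
    simp only [LinearMap.sum_apply, LinearMap.smul_apply, SS_self_apply hmem, hk, smul_smul]
    rw [← sum_smul, ← sum_mul, sum_add_distrib, sum_triple_self]
    congr 2
    simp
    ring
  rw [LinearMap.add_apply, hself, LinearMap.sub_apply, LinearMap.smul_apply,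
    LinearMap.smul_apply, dotSum_one_hsState_pow k hN, LinearMap.sum_apply] at hdot
  rw [hamiltonian_eq]
  simp only [LinearMap.smul_apply, LinearMap.sub_apply, LinearMap.sum_apply, hanti]
  rw [← smul_sum, sum_add_distrib, ← smul_sum, ← smul_sum, hdot, ← LinearMap.sum_apply,
    ← pairSum]
  have hc : ((1 / (2 * (S + 1) * (2 * S + 3)) : ℝ) : ℂ) * (S + 1) = 1 / (2 * (2 * S + 3)) := by
    push_cast
    field_simp
  rw [smul_smul, hc, energy]
  push_cast
  generalize pairSum N f = g
  rw [smul_zero, sub_zero]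
  -- The coefficient of `g` is a multiple of `1 - (4 (S + 1) + 2) / (2 (2 S + 3)) = 0`; that of the
  -- state is the energy.
  match_scalars
  · field_simp
    ring
  · field_simp

end SpinChain

end

open scoped ComplexConjugate in
theorem mainTheorem1 (N : ℕ) (hN : Even N) (hN0 : 0 < N) (twoS : ℕ) (S : ℝ)
    (hS : S = (twoS : ℝ) / 2) :
    -- the Hamiltonian acts on the state space of the spin `S` chain, which contains the state
    (∀ φ ∈ SpinChain.spinSpace N twoS,
        SpinChain.hamiltonian N S φ ∈ SpinChain.spinSpace N twoS) ∧
    SpinChain.spinLiquid N twoS ∈ SpinChain.spinSpace N twoS ∧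
    -- the state is non-zero and is an eigenstate with the stated energy
    SpinChain.spinLiquid N twoS ≠ 0 ∧
    SpinChain.hamiltonian N S (SpinChain.spinLiquid N twoS)
      = (SpinChain.energy N S : ℂ) • SpinChain.spinLiquid N twoS ∧
    -- the second form of the Hamiltonian
    SpinChain.hamiltonian N S =
      ((2 * Real.pi ^ 2 / N ^ 2 : ℝ) : ℂ) •
        ((∑ α : Fin N, ∑ β : Fin N with α ≠ β,
            ((1 / ‖SpinChain.η α - SpinChain.η β‖ ^ 2 : ℝ) : ℂ) • SpinChain.SS α β)
          - ∑ α : Fin N, ∑ β : Fin N with α ≠ β, ∑ γ : Fin N with α ≠ γ,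
              (((1 / ((conj (SpinChain.η α) - conj (SpinChain.η β))
                  * (SpinChain.η α - SpinChain.η γ))).re / ((S + 1) * (2 * S + 3)) : ℝ) : ℂ) •
                (SpinChain.SS α β * SpinChain.SS α γ)) ∧
    -- the second form of the energy
    SpinChain.energy N S =
      -(Real.pi ^ 2 / 6) * (S * (S + 1) ^ 2 / (2 * S + 3)) * (N + 5 / N) := by
  have hNR : (N : ℝ) ≠ 0 := by exact_mod_cast hN0.ne'
  obtain ⟨n, hn⟩ := hN
  obtain ⟨m, rfl⟩ : ∃ m, n = m + 1 := ⟨n - 1, by omega⟩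
  have hm : N = 2 * (m + 1) := by omega
  refine ⟨fun φ hφ => SpinChain.hamiltonian_mem_spinSpace hφ S, ?_, ?_, ?_,
    SpinChain.hamiltonian_eq_re S, ?_⟩
  · rw [SpinChain.spinLiquid_eq]
    exact SpinChain.hsState_pow_mem_spinSpace twoS
  · rw [SpinChain.spinLiquid_eq]
    exact pow_ne_zero _ SpinChain.hsState_ne_zero
  · rw [SpinChain.spinLiquid_eq]
    exact SpinChain.hamiltonian_hsState_pow hm twoS hS
  · rw [SpinChain.energy]
    generalize S * (S + 1) ^ 2 / (2 * S + 3) = e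
    field_simp
    ring
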